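/- Let $p_1,\dots,p_r$ be distinct odd primes. For $1\le i\le r$ and integers $n\ge 1$ put $$\alpha_i(n) := p_i^{\{n\log 2/\log p_i\}-1},$$ where $\{x\}$ denotes the fractional part of $x$, and for integers $H\ge 1$ put $$U_i(H) := \left\{\frac{d_1}{p_i}+\frac{d_2}{p_i^2}+\cdots+\frac{d_H}{p_i^H}\ :\ d_1,\dots,d_H\in\mathbb Z,\ 0\le d_1,\dots,d_H\le \frac{p_i}{3}\right\}+\left[0,\frac1{p_i^H}\right).$$ Then there is a function $H_0:\mathbb N\to\mathbb N$ with $H_0(N)\to\infty$, depending only on $p_1,\dots,p_r$, such that the following holds for every function $H=H(N)$ with positive integer values for which $H(N)\to\infty$ as $N\to\infty$ and $H(N)\le H_0(N)$ for all sufficiently large $N$: for arbitrary sequences of real numbers $\{\beta_i(n)\}_{n=1}^\infty$, $i=1,\dots,r$, $$\frac{\#\{1\le n\le N\ :\ \exists\, s\in\mathbb Z,\ 1\le s\le 10^{10r^2H(N)},\ \forall j=1,\dots,r,\ \{s\,\alpha_j(n)+\beta_j(n)\}\in U_j(H(N))\}}{N}\ \ge\ 1-o(1)$$ as $N\to\infty$,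 where the $o(1)$ term may depend on $p_1,\dots,p_r$ and on the function $H$, but not on the sequences $\beta_i$. -/

import Mathlib

open Filter Topology
open scoped Pointwise

noncomputable section

/-- `α_p(n) = p ^ ({n log 2 / log p} - 1)`, where `{x}` is the fractional part of `x`. -/
def alphaSeq (p n : ℕ) : ℝ :=
  (p : ℝ) ^ (Int.fract ((n : ℝ) * Real.log 2 / Real.log p) - 1)

/-- The set of all `d₁ / p + d₂ / p² + ⋯ + d_H / p ^ H` with integers `0 ≤ d₁, …, d_H ≤ p / 3`,
plus (as a sumset) the interval `[0, 1 / p ^ H)`. -/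
def smallDigitSet (p H : ℕ) : Set ℝ :=
  {x : ℝ | ∃ d : Fin H → ℕ, (∀ k, (d k : ℝ) ≤ (p : ℝ) / 3) ∧
      x = ∑ k : Fin H, (d k : ℝ) / (p : ℝ) ^ ((k : ℕ) + 1)} +
    Set.Ico (0 : ℝ) (1 / (p : ℝ) ^ H)

/-- The integers `1 ≤ n ≤ N` for which some integer `1 ≤ s ≤ 10 ^ (10 r² H)` puts
`{s α_j(n) + β_j(n)}` into `U_j(H)` for all `j` simultaneously. -/
def goodSet {r : ℕ} (p : Fin r → ℕ) (β : Fin r → ℕ → ℝ) (H N : ℕ) : Set ℕ :=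
  {n : ℕ | 1 ≤ n ∧ n ≤ N ∧ ∃ s : ℕ, 1 ≤ s ∧ s ≤ 10 ^ (10 * r ^ 2 * H) ∧
    ∀ j : Fin r,
      Int.fract ((s : ℝ) * alphaSeq (p j) n + β j n) ∈ smallDigitSet (p j) H}

end

/-!
Put `θ_i = log 2 / log p_i`, so that `α_i(n) = p_i ^ ({n θ_i} - 1)`, and let `S = 10 ^ (10 r² H)`.
Call `n` exceptional if some shift `b ∈ ℝ ^ r` admits no `1 ≤ s ≤ S` with
`{s α_j(n) + b_j} ∈ U_j(H)` for all `j`. This notion does not involve the sequences `β_j`, and it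
suffices to bound the upper density of the exceptional integers, for each fixed `H`, by a quantity that
tends to `0` as `H → ∞`; a function `H₀` of slow growth is then chosen diagonally.

*Fourier analysis.* A product of tents detects `U_1(H) × ⋯ × U_r(H)`. Its Fourier coefficients have
absolute sum at most `1`, because a tent has nonnegative coefficients that add up to its peak value, and
its mean is at least `(4 · 50 ^ H) ^ (-r)` whatever the primes (`exists_digitBump`,
`exists_hasFourierBall_smallDigitSet`). If `n` is exceptional, the constant term is dominated by the
Weyl sums `S⁻¹ ∑_{s ≤ S} exp (2 π i s M · α(n))` at the frequencies `M ≠ 0`, weighted by the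
coefficients (`HasFourierBall.norm_zero_le`). It remains to see that every such Weyl sum has average
`O(q⁻¹)` over `n`, with `q = 100 ^ (r H)` and a constant independent of `M` and `H`: since `100 > 50`,
Markov's inequality concludes.

*From `n` to a flow.* The joint distribution of the `n θ_i` modulo `1` depends on the unknown rational
relations between `1, θ_1, …, θ_r`. However, as each `θ_i` is irrational, there is `v ∈ ℤ ^ r` with
nonzero coordinates that is orthogonal to all of these relations (`exists_direction`), and by Weyl's
criterion averages along `n θ` are asymptotically unchanged when each point is replaced by its
closed orbit `n θ + t v`, `t ∈ [0, 1]` (`tendsto_average_flowDefect`).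

*Exponential sums.* Along such an orbit `M · α` is piecewise of the form
`f(t) = ∑ a_i exp (μ_i t)` with `μ_i = v_i log p_i`, and these exponents are distinct and nonzero by
unique factorization. A repeated use of the mean value theorem shows that `f'` is small only near few
points (`abs_coeff_le_of_separated`). Elsewhere `f` moves quickly through the integers, so that `f`
is within `q ^ (-3 r)` of an integer on a set of measure `O(q⁻¹)` only
(`exists_volume_near_int_le`). Off this set the geometric sum is small, as `S ≥ q ^ (4 r)`
(`exists_integral_weylMean_le`).
-/

open MeasureTheory

/-! ### Sublevel sets of exponential sums -/

/-- An exponential sum `∑ a i * exp (μ i * t)` that is at most `δ` at `2 ^ #s` points of `[0, 1]`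
separated by at least `τ` has a small coefficient at each of its `#s + 1` exponents. The operator
`f ↦ f' - μ f = exp (μ t) * (exp (-μ t) * f)'` removes one exponent, and the mean value theorem on
disjoint pairs of consecutive points keeps half of the points. -/
lemma abs_coeff_le_of_separated {ι : Type*} [DecidableEq ι] (μ : ι → ℝ) {R τ : ℝ}
    (hR : ∀ i, |μ i| ≤ R) (hτ : 0 < τ) (j : ι) (s : Finset ι) (hj : j ∉ s) :
    ∀ (a : ι → ℝ) (δ : ℝ) (t : ℕ → ℝ),
      (∀ k < 2 ^ s.card, t k ∈ Set.Icc (0 : ℝ) 1) →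
      (∀ k, k + 1 < 2 ^ s.card → t k + τ ≤ t (k + 1)) →
      (∀ k < 2 ^ s.card, |∑ i ∈ insert j s, a i * Real.exp (μ i * t k)| ≤ δ) →
      |a j| * (∏ i ∈ s, |μ j - μ i|) * Real.exp (-R) ≤ (2 * Real.exp (2 * R) / τ) ^ s.card * δ := by
  have hexp : ∀ i, ∀ x ∈ Set.Icc (0 : ℝ) 1, |μ i * x| ≤ R := by
    intro i x hx
    rw [abs_mul, abs_of_nonneg hx.1]
    nlinarith [hR i, hx.1, hx.2, abs_nonneg (μ i)]
  induction s using Finset.induction_on with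
  | empty =>
    intro a δ t ht _ hf
    have h0 := hf 0 (by simp)
    simp only [insert_empty_eq, Finset.sum_singleton, abs_mul, Real.abs_exp] at h0
    have h1 : Real.exp (-R) ≤ Real.exp (μ j * t 0) :=
      Real.exp_le_exp.2 (abs_le.1 (hexp j _ (ht 0 (by simp)))).1
    simp only [Finset.prod_empty, Finset.card_empty, pow_zero, one_mul, mul_one]
    exact (mul_le_mul_of_nonneg_left h1 (abs_nonneg _)).trans h0
  | insert m s hm ih =>
    intro a δ t ht hgap hf
    have hjs : j ∉ s := fun h => hj (Finset.mem_insert_of_mem h)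
    have hjm : j ≠ m := fun h => hj (h ▸ Finset.mem_insert_self _ _)
    rw [Finset.card_insert_of_notMem hm] at ht hgap hf ⊢
    rw [pow_succ] at ht hgap hf
    set b : ι → ℝ := fun i => a i * (μ i - μ m) with hb
    -- `f₁` is `f' - μ m * f`, which no longer contains the exponent `μ m`
    have hder : ∀ x : ℝ, HasDerivAt
        (fun y => Real.exp (-(μ m) * y) * ∑ i ∈ insert j (insert m s), a i * Real.exp (μ i * y))
        (Real.exp (-(μ m) * x) * ∑ i ∈ insert j s, b i * Real.exp (μ i * x)) x := by
      intro x
      have h1 : HasDerivAt (fun y => Real.exp (-(μ m) * y)) (Real.exp (-(μ m) * x) * (-(μ m))) x := by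
        simpa using ((hasDerivAt_id x).const_mul (-(μ m))).exp
      have h2 : HasDerivAt (fun y => ∑ i ∈ insert j (insert m s), a i * Real.exp (μ i * y))
          (∑ i ∈ insert j (insert m s), a i * (Real.exp (μ i * x) * μ i)) x := by
        apply HasDerivAt.fun_sum
        intro i _
        have := (((hasDerivAt_id x).const_mul (μ i)).exp).const_mul (a i)
        simpa using this
      refine (h1.fun_mul h2).congr_deriv ?_
      rw [mul_assoc, ← mul_add, Finset.mul_sum, ← Finset.sum_add_distrib]
      congr 1
      rw [Finset.insert_comm, Finset.sum_insert (a := m)]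
      · have : -μ m * (a m * Real.exp (μ m * x)) + a m * (Real.exp (μ m * x) * μ m) = 0 := by ring
        rw [this, zero_add]
        exact Finset.sum_congr rfl fun i _ => by simp only [hb]; ring
      · simp [hm, Ne.symm hjm]
    have hmv : ∀ k, ∃ ξ, k < 2 ^ s.card → (t (2 * k) ≤ ξ ∧ ξ ≤ t (2 * k + 1) ∧
        |∑ i ∈ insert j s, b i * Real.exp (μ i * ξ)| ≤ 2 * Real.exp (2 * R) / τ * δ) := by
      intro k
      by_cases hk : k < 2 ^ s.card
      swap
      · exact ⟨0, fun h => absurd h hk⟩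
      have hg := hgap (2 * k) (by omega)
      have hlt : t (2 * k) < t (2 * k + 1) := by linarith
      obtain ⟨ξ, hξ, hξe⟩ := exists_hasDerivAt_eq_slope _ _ hlt
        (fun x _ => (hder x).continuousAt.continuousWithinAt) (fun x _ => hder x)
      refine ⟨ξ, fun _ => ⟨hξ.1.le, hξ.2.le, ?_⟩⟩
      have ht0 := ht (2 * k) (by omega)
      have ht1 := ht (2 * k + 1) (by omega)
      have hξI : ξ ∈ Set.Icc (0 : ℝ) 1 := ⟨ht0.1.trans hξ.1.le, hξ.2.le.trans ht1.2⟩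
      have hδ0 : 0 ≤ δ := (abs_nonneg _).trans (hf (2 * k) (by omega))
      have hval : ∀ l < 2 ^ s.card * 2, |Real.exp (-(μ m) * t l) *
          ∑ i ∈ insert j (insert m s), a i * Real.exp (μ i * t l)| ≤ Real.exp R * δ := by
        intro l hl
        rw [abs_mul, Real.abs_exp]
        refine mul_le_mul (Real.exp_le_exp.2 ?_) (hf l hl) (abs_nonneg _) (Real.exp_pos _).le
        have := (abs_le.1 (hexp m _ (ht l hl))).1
        linarith
      have hnum := abs_le.1 (hval (2 * k) (by omega))
      have hnum' := abs_le.1 (hval (2 * k + 1) (by omega))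
      set f1 := ∑ i ∈ insert j s, b i * Real.exp (μ i * ξ) with hf1
      have hslope : |Real.exp (-(μ m) * ξ) * f1| ≤ 2 * Real.exp R * δ / τ := by
        rw [hξe, abs_div, abs_of_pos (by linarith : 0 < t (2 * k + 1) - t (2 * k))]
        have h3 := Real.exp_pos R
        exact div_le_div₀ (by positivity) (abs_le.2 ⟨by linarith, by linarith⟩) hτ (by linarith)
      have hf1e : f1 = Real.exp (μ m * ξ) * (Real.exp (-(μ m) * ξ) * f1) := by
        rw [← mul_assoc, ← Real.exp_add]; simp
      rw [hf1e, abs_mul, Real.abs_exp]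
      calc Real.exp (μ m * ξ) * |Real.exp (-μ m * ξ) * f1|
          ≤ Real.exp R * (2 * Real.exp R * δ / τ) :=
            mul_le_mul (Real.exp_le_exp.2 (abs_le.1 (hexp m _ hξI)).2) hslope (abs_nonneg _)
              (Real.exp_pos _).le
        _ = 2 * Real.exp (2 * R) / τ * δ := by
            rw [two_mul R, Real.exp_add]; ring
    choose ξ hξ using hmv
    have key := ih hjs b (2 * Real.exp (2 * R) / τ * δ) ξ
      (fun k hk => ⟨(ht (2 * k) (by omega)).1.trans (hξ k hk).1,
        (hξ k hk).2.1.trans (ht (2 * k + 1) (by omega)).2⟩)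
      (fun k hk => by
        have h1 := (hξ k (by omega)).2.1
        have h2 := (hξ (k + 1) hk).1
        have h3 := hgap (2 * k + 1) (by omega)
        rw [show 2 * (k + 1) = 2 * k + 1 + 1 by ring] at h2
        linarith)
      (fun k hk => (hξ k hk).2.2)
    rw [Finset.prod_insert hm, pow_succ]
    calc |a j| * (|μ j - μ m| * ∏ i ∈ s, |μ j - μ i|) * Real.exp (-R)
        = |b j| * (∏ i ∈ s, |μ j - μ i|) * Real.exp (-R) := by
          simp only [hb, abs_mul]; ring
      _ ≤ _ := key
      _ = _ := by ring

/-- From a set of at least `m * g` natural numbers one can select `m` with gaps at least `g`. -/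
lemma exists_spaced_of_card {s : Finset ℕ} {m g : ℕ} (hg : 0 < g) (h : m * g ≤ s.card) :
    ∃ b : ℕ → ℕ, (∀ k < m, b k ∈ s) ∧ ∀ k, k + 1 < m → b k + g ≤ b (k + 1) := by
  have hstep : ∀ (n : ℕ) (i : ℕ) (hi : i + n < s.card),
      s.orderEmbOfFin rfl ⟨i, by omega⟩ + n ≤ s.orderEmbOfFin rfl ⟨i + n, hi⟩ := by
    intro n
    induction n with
    | zero => intro i hi; simp
    | succ n ih =>
      intro i hi
      have h1 := ih i (by omega)
      have h2 : s.orderEmbOfFin rfl ⟨i + n, by omega⟩ < s.orderEmbOfFin rfl ⟨i + (n + 1), hi⟩ :=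
        (s.orderEmbOfFin rfl).strictMono (by simp [Fin.lt_def])
      omega
  have hlt : ∀ k < m, k * g < s.card := fun k hk =>
    lt_of_lt_of_le (Nat.mul_lt_mul_of_pos_right hk hg) h
  refine ⟨fun k => if hk : k < m then s.orderEmbOfFin rfl ⟨k * g, hlt k hk⟩ else 0, ?_, ?_⟩
  · intro k hk
    simp only [hk, dif_pos]
    exact s.orderEmbOfFin_mem rfl _
  · intro k hk
    have hk' : k < m := by omega
    simp only [hk, hk', dif_pos]
    have h1 := hstep g (k * g) (by have := hlt (k + 1) hk; rwa [Nat.succ_mul] at this)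
    have h2 : (⟨(k + 1) * g, hlt _ hk⟩ : Fin s.card) = ⟨k * g + g, by
      have := hlt (k + 1) hk; rwa [Nat.succ_mul] at this⟩ := by
      ext; simp [Nat.succ_mul]
    rw [h2]; exact h1

/-- Only few cells `[k / N, (k + 1) / N]` contain a point at which the derivative of the exponential
sum `∑ a i * exp (μ i * t)` is small compared with one of its coefficients. -/
lemma exists_card_cells_le {ι : Type*} [Fintype ι] [DecidableEq ι] (μ : ι → ℝ)
    (hμ : Function.Injective μ) (h0 : ∀ i, μ i ≠ 0) :
    ∃ T Q : ℝ, 1 ≤ T ∧ 1 ≤ Q ∧ ∀ (a : ι → ℝ) (j : ι), a j ≠ 0 → ∀ q : ℝ, Q < q → ∀ N : ℕ, 0 < N →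
      ∀ s : Finset ℕ, s ⊆ Finset.range N →
      (∀ k ∈ s, ∃ x ∈ Set.Icc ((k : ℝ) / N) ((k + 1 : ℝ) / N),
        |∑ i, a i * μ i * Real.exp (μ i * x)| ≤ |a j| / q ^ Fintype.card ι) →
      (s.card : ℝ) ≤ 2 ^ Fintype.card ι * (T * N / q + 2) := by
  set R : ℝ := ∑ i, |μ i| with hRdef
  have hR : ∀ i, |μ i| ≤ R := fun i =>
    Finset.single_le_sum (f := fun i => |μ i|) (fun i _ => abs_nonneg _) (Finset.mem_univ i)
  set c : ι → ℝ := fun j =>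
    |μ j| * (∏ i ∈ Finset.univ.erase j, |μ j - μ i|) * Real.exp (-R) with hc
  have hcpos : ∀ j, 0 < c j := by
    intro j
    refine mul_pos (mul_pos (abs_pos.2 (h0 j)) (Finset.prod_pos fun i hi => ?_)) (Real.exp_pos _)
    exact abs_pos.2 (sub_ne_zero.2 fun h => (Finset.ne_of_mem_erase hi) (hμ h).symm)
  set D : ℝ := 2 * Real.exp (2 * R) with hD
  have hDpos : 0 < D := by positivity
  set Q : ℝ := 1 + ∑ j, 1 / c j with hQ
  have hQj : ∀ j, 1 / c j ≤ Q := by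
    intro j
    have := Finset.single_le_sum (f := fun j => 1 / c j)
      (fun i _ => (one_div_pos.2 (hcpos i)).le) (Finset.mem_univ j)
    linarith
  have hQ1 : 1 ≤ Q := by
    have : 0 ≤ ∑ j, 1 / c j := Finset.sum_nonneg fun i _ => (one_div_pos.2 (hcpos i)).le
    linarith
  refine ⟨D + 1, Q, by linarith, hQ1, ?_⟩
  intro a j haj q hq N hN s hs hsmall
  have hq0 : 0 < q := by linarith
  have hNR : (0 : ℝ) < N := by exact_mod_cast hN
  set r := Fintype.card ι with hr
  have hrpos : 0 < r := Fintype.card_pos_iff.2 ⟨j⟩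
  set g : ℕ := ⌈(D + 1) * N / q⌉₊ + 1 with hg
  have hgT : (D + 1) * N / q ≤ ((g - 1 : ℕ) : ℝ) := by simpa [hg] using Nat.le_ceil _
  have hgle : (g : ℝ) ≤ (D + 1) * N / q + 2 := by
    have := (Nat.ceil_lt_add_one (show 0 ≤ (D + 1) * N / q by positivity)).le
    rw [hg]; push_cast; linarith
  by_contra hcon
  push Not at hcon
  have hcard : 2 ^ (r - 1) * g ≤ s.card := by
    have h1 : ((2 ^ (r - 1) * g : ℕ) : ℝ) ≤ 2 ^ r * ((D + 1) * N / q + 2) := by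
      push_cast
      exact mul_le_mul (pow_le_pow_right₀ (by norm_num) (Nat.sub_le _ _)) hgle (by positivity)
        (by positivity)
    exact_mod_cast (h1.trans_lt hcon).le
  obtain ⟨b, hbs, hbg⟩ := exists_spaced_of_card (by omega) hcard
  have hx : ∀ k, ∃ x, k < 2 ^ (r - 1) → x ∈ Set.Icc ((b k : ℝ) / N) ((b k + 1 : ℝ) / N) ∧
      |∑ i, a i * μ i * Real.exp (μ i * x)| ≤ |a j| / q ^ r := by
    intro k
    by_cases hk : k < 2 ^ (r - 1)
    · obtain ⟨x, hx, hx'⟩ := hsmall _ (hbs k hk)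
      exact ⟨x, fun _ => ⟨hx, hx'⟩⟩
    · exact ⟨0, fun h => absurd h hk⟩
  choose x hx using hx
  have hscard : (Finset.univ.erase j).card = r - 1 := by
    rw [Finset.card_erase_of_mem (Finset.mem_univ j), Finset.card_univ]
  -- with separation `(D + 1) / q`, removing one exponent costs a factor of at most `q`
  have key := abs_coeff_le_of_separated μ hR (τ := (D + 1) / q) (by positivity) j
    (Finset.univ.erase j) (Finset.notMem_erase _ _) (fun i => a i * μ i) (|a j| / q ^ r) x
    (by
      rw [hscard]
      intro k hk
      have h1 := (hx k hk).1
      have h2 : b k < N := Finset.mem_range.1 (hs (hbs k hk))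
      refine ⟨le_trans (by positivity) h1.1, h1.2.trans ?_⟩
      rw [div_le_one hNR]
      exact_mod_cast h2)
    (by
      rw [hscard]
      intro k hk
      have h1 := (hx k (by omega)).1.2
      have h2 := (hx (k + 1) hk).1.1
      have h3 : (b k : ℝ) + 1 + ((g - 1 : ℕ) : ℝ) ≤ b (k + 1) := by
        have := hbg k hk
        exact_mod_cast (by omega : b k + 1 + (g - 1) ≤ b (k + 1))
      have h4 : (b k + 1 : ℝ) / N + (D + 1) / q ≤ b (k + 1) / N := by
        rw [le_div_iff₀ hNR, add_mul, div_mul_cancel₀ _ hNR.ne']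
        have : (D + 1) / q * N = (D + 1) * N / q := by ring
        linarith
      linarith)
    (by
      rw [hscard, Finset.insert_erase (Finset.mem_univ j)]
      intro k hk
      exact (hx k hk).2)
  rw [hscard, ← hD] at key
  have hapos : 0 < |a j| := abs_pos.2 haj
  have h1 : |a j| * c j ≤ |a j| * (1 / q) := by
    calc |a j| * c j = |a j * μ j| * (∏ i ∈ Finset.univ.erase j, |μ j - μ i|) * Real.exp (-R) := by
          rw [hc, abs_mul]; ring
      _ ≤ (D / ((D + 1) / q)) ^ (r - 1) * (|a j| / q ^ r) := key
      _ ≤ q ^ (r - 1) * (|a j| / q ^ r) := by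
          gcongr
          rw [div_div_eq_mul_div, div_le_iff₀ (by positivity)]
          nlinarith
      _ = |a j| * (1 / q) := by
          obtain ⟨r', hr'⟩ : ∃ r', r = r' + 1 := ⟨r - 1, by omega⟩
          rw [hr', Nat.add_sub_cancel, pow_succ]
          field_simp
  have h2 : c j ≤ 1 / q := le_of_mul_le_mul_left h1 hapos
  have h3 : q ≤ 1 / c j := by
    rw [le_div_iff₀ (hcpos j)]
    rw [le_div_iff₀ hq0] at h2
    linarith
  linarith [hQj j]

/-- An exponential sum with a coefficient bounded away from zero is rarely close to an integer,
uniformly in the size of its coefficients. -/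
lemma exists_volume_near_int_le {ι : Type*} [Fintype ι] [Nonempty ι] (μ : ι → ℝ)
    (hμ : Function.Injective μ) (h0 : ∀ i, μ i ≠ 0) {a₀ : ℝ} (ha₀ : 0 < a₀) :
    ∃ C : ℝ, 0 < C ∧ ∀ a : ι → ℝ, (∃ i, a₀ ≤ |a i|) → ∀ q : ℝ, 1 ≤ q →
      volume {t : ℝ | t ∈ Set.Ioc (0 : ℝ) 1 ∧
        |(∑ i, a i * Real.exp (μ i * t)) - round (∑ i, a i * Real.exp (μ i * t))|
          < 1 / q ^ (3 * Fintype.card ι)} ≤ ENNReal.ofReal (C / q) := by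
  classical
  obtain ⟨T, Q, hT, hQ, hcells⟩ := exists_card_cells_le μ hμ h0
  set r := Fintype.card ι with hr
  have hrpos : 0 < r := Fintype.card_pos
  set R : ℝ := ∑ i, |μ i| with hRdef
  have hR : ∀ i, |μ i| ≤ R := fun i =>
    Finset.single_le_sum (f := fun i => |μ i|) (fun i _ => abs_nonneg _) (Finset.mem_univ i)
  have hR0 : 0 ≤ R := Finset.sum_nonneg fun i _ => abs_nonneg _
  set B : ℝ := r * (R * Real.exp R) with hB
  have hB0 : 0 ≤ B := by positivity
  have hC0 : 0 ≤ 2 ^ r * (T + 2) + 8 * B + 4 / a₀ := by positivity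
  refine ⟨(Q + 2) + (2 ^ r * (T + 2) + 8 * B + 4 / a₀), by linarith, ?_⟩
  intro a ha q hq
  have hq0 : 0 < q := by linarith
  by_cases hqQ : q ≤ Q + 2
  · -- the bound exceeds the length of the whole interval
    calc volume {t : ℝ | t ∈ Set.Ioc (0 : ℝ) 1 ∧ _} ≤ volume (Set.Ioc (0 : ℝ) 1) :=
          measure_mono fun t ht => ht.1
      _ = ENNReal.ofReal 1 := by simp
      _ ≤ _ := ENNReal.ofReal_le_ofReal (by rw [le_div_iff₀ hq0]; linarith)
  push Not at hqQ
  have hq2 : 2 ≤ q := by linarith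
  obtain ⟨j, hj⟩ := Finite.exists_max fun i => |a i|
  have hA : a₀ ≤ |a j| := by obtain ⟨i, hi⟩ := ha; exact hi.trans (hj i)
  set A := |a j| with hAdef
  have hA0 : 0 < A := by linarith
  set f : ℝ → ℝ := fun t => ∑ i, a i * Real.exp (μ i * t) with hf
  set f' : ℝ → ℝ := fun t => ∑ i, a i * μ i * Real.exp (μ i * t) with hf'
  have hder : ∀ t, HasDerivAt f (f' t) t := by
    intro t
    apply HasDerivAt.fun_sum
    intro i _
    have := (((hasDerivAt_id t).const_mul (μ i)).exp).const_mul (a i)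
    refine this.congr_deriv ?_
    simp only [id_eq, mul_one]; ring
  have hf'le : ∀ t ∈ Set.Icc (0 : ℝ) 1, |f' t| ≤ B * A := by
    intro t ht
    calc |f' t| ≤ ∑ i, |a i * μ i * Real.exp (μ i * t)| := Finset.abs_sum_le_sum_abs _ _
      _ ≤ ∑ _i : ι, A * R * Real.exp R := by
          refine Finset.sum_le_sum fun i _ => ?_
          rw [abs_mul, abs_mul, Real.abs_exp]
          have h1 : μ i * t ≤ R := by
            nlinarith [hR i, ht.1, ht.2, abs_nonneg (μ i), le_abs_self (μ i)]
          gcongr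
          · exact hj i
          · exact hR i
      _ = B * A := by rw [Finset.sum_const, Finset.card_univ, nsmul_eq_mul, hB]; ring
  -- `f` varies by at most `1 / 4` on a cell, so it stays near a single integer there
  set N : ℕ := ⌈4 * (B * A) + q⌉₊ with hN
  have hNge : 4 * (B * A) + q ≤ N := Nat.le_ceil _
  have hNle : (N : ℝ) ≤ 4 * (B * A) + 2 * q := by
    have := (Nat.ceil_lt_add_one (show 0 ≤ 4 * (B * A) + q by positivity)).le
    linarith
  have hBA : 0 ≤ B * A := by positivity
  have hNR : (0 : ℝ) < N := by linarith
  have hNpos : 0 < N := by exact_mod_cast hNR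
  set δ : ℝ := 1 / q ^ (3 * r) with hδ
  have hδ0 : 0 < δ := by positivity
  have hδ8 : δ ≤ 1 / 8 := by
    rw [hδ]
    apply one_div_le_one_div_of_le (by norm_num)
    calc (8 : ℝ) = 2 ^ 3 := by norm_num
      _ ≤ q ^ 3 := by gcongr
      _ ≤ q ^ (3 * r) := pow_le_pow_right₀ hq (by omega)
  set cell : ℕ → Set ℝ := fun k => Set.Icc ((k : ℝ) / N) ((k + 1 : ℝ) / N) with hcell
  have hcellsub : ∀ k < N, cell k ⊆ Set.Icc (0 : ℝ) 1 := by
    intro k hk x hx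
    refine ⟨le_trans (by positivity) hx.1, hx.2.trans ?_⟩
    rw [div_le_one hNR]; exact_mod_cast hk
  set S : Set ℝ := {t : ℝ | t ∈ Set.Ioc (0 : ℝ) 1 ∧ |f t - round (f t)| < δ} with hS
  set bad : Finset ℕ := (Finset.range N).filter fun k => ∃ x ∈ cell k, |f' x| ≤ A / q ^ r with hbad
  have hbadcard : (bad.card : ℝ) ≤ 2 ^ r * (T * N / q + 2) :=
    hcells a j (abs_pos.1 hA0) q (by linarith) N hNpos bad (Finset.filter_subset _ _)
      fun k hk => (Finset.mem_filter.1 hk).2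
  have hcov : S ⊆ ⋃ k ∈ Finset.range N, (cell k ∩ S) := by
    intro t ht
    have htN : 0 < t * N := mul_pos ht.1.1 hNR
    have hc1 : 0 < ⌈t * N⌉₊ := Nat.ceil_pos.2 htN
    have hc2 : ⌈t * N⌉₊ ≤ N := Nat.ceil_le.2 (by nlinarith [ht.1.2])
    simp only [Set.mem_iUnion, Finset.mem_range]
    refine ⟨⌈t * N⌉₊ - 1, by omega, ⟨?_, ?_⟩, ht⟩
    · rw [div_le_iff₀ hNR]
      exact (Nat.lt_ceil.1 (by omega)).le
    · rw [le_div_iff₀ hNR]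
      have h1 := Nat.le_ceil (t * N)
      rw [← Nat.sub_add_cancel (show 1 ≤ ⌈t * N⌉₊ from hc1)] at h1
      push_cast at h1
      exact h1
  have hbadvol : ∀ k, volume (cell k ∩ S) ≤ ENNReal.ofReal (1 / N) := by
    intro k
    refine (measure_mono Set.inter_subset_left).trans ?_
    rw [hcell, Real.volume_Icc]
    apply ENNReal.ofReal_le_ofReal
    rw [← sub_div]; simp
  set η : ℝ := 2 / (q ^ (2 * r) * A) with hη
  have hη0 : 0 < η := by positivity
  -- on a cell without a point of small derivative, the sublevel set has small diameter
  have hgoodvol : ∀ k ∈ Finset.range N, k ∉ bad → volume (cell k ∩ S) ≤ ENNReal.ofReal η := by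
    intro k hk hkb
    have hkN := Finset.mem_range.1 hk
    have hbig : ∀ x ∈ cell k, A / q ^ r < |f' x| := by
      intro x hx
      by_contra hcon
      exact hkb (Finset.mem_filter.2 ⟨hk, x, hx, not_lt.1 hcon⟩)
    have hpair : ∀ x ∈ cell k ∩ S, ∀ y ∈ cell k ∩ S, x < y → y - x ≤ η := by
      intro x hx y hy hxy
      obtain ⟨ξ, hξ, hξe⟩ := exists_hasDerivAt_eq_slope f f' hxy
        (fun z _ => (hder z).continuousAt.continuousWithinAt) (fun z _ => hder z)
      have hξc : ξ ∈ cell k := ⟨hx.1.1.trans hξ.1.le, hξ.2.le.trans hy.1.2⟩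
      have hyx : 0 < y - x := by linarith
      have hfe : f y - f x = f' ξ * (y - x) := by
        rw [hξe]; field_simp
      have hcl : y - x ≤ 1 / N := by
        have h1 := hy.1.2
        have h2 := hx.1.1
        rw [add_div] at h1
        linarith
      have hchange : |f y - f x| ≤ 1 / 4 := by
        rw [hfe, abs_mul, abs_of_pos hyx]
        calc |f' ξ| * (y - x) ≤ (B * A) * (1 / N) :=
              mul_le_mul (hf'le ξ (hcellsub k hkN hξc)) hcl hyx.le hBA
          _ ≤ 1 / 4 := by
              rw [mul_one_div, div_le_iff₀ hNR]; linarith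
      have hxS := abs_lt.1 hx.2.2
      have hyS := abs_lt.1 hy.2.2
      have hch := abs_le.1 hchange
      have hround : round (f x) = round (f y) := by
        have h1 : |(round (f x) : ℝ) - round (f y)| < 1 :=
          abs_lt.2 ⟨by linarith, by linarith⟩
        have h2 : |round (f x) - round (f y)| < 1 := by exact_mod_cast h1
        have h3 := Int.abs_lt_one_iff.1 h2
        omega
      have hsmall : |f y - f x| ≤ 2 * δ := by
        rw [hround] at hxS
        exact abs_le.2 ⟨by linarith, by linarith⟩
      rw [hfe, abs_mul, abs_of_pos hyx] at hsmall
      have h4 : A / q ^ r * (y - x) ≤ 2 * δ :=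
        (mul_le_mul_of_nonneg_right (hbig ξ hξc).le hyx.le).trans hsmall
      rw [hη, le_div_iff₀ (by positivity)]
      rw [hδ, div_mul_eq_mul_div, div_le_iff₀ (by positivity)] at h4
      have h5 : (y - x) * (q ^ (2 * r) * A) = (A * (y - x)) * q ^ (2 * r) := by ring
      have h6 : 2 * (1 / q ^ (3 * r)) * q ^ r * q ^ (2 * r) = 2 := by
        have : q ^ (3 * r) = q ^ r * q ^ (2 * r) := by rw [← pow_add]; ring_nf
        rw [this]; field_simp
      rw [h5, ← h6]
      exact mul_le_mul_of_nonneg_right h4 (by positivity)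
    refine (Real.volume_le_diam _).trans ?_
    apply Metric.ediam_le
    intro x hx y hy
    rw [edist_dist, Real.dist_eq]
    apply ENNReal.ofReal_le_ofReal
    rcases lt_trichotomy x y with h | h | h
    · rw [abs_sub_comm, abs_of_pos (by linarith)]; exact hpair x hx y hy h
    · rw [h]; simpa using hη0.le
    · rw [abs_of_pos (by linarith)]; exact hpair y hy x hx h
  calc volume S ≤ volume (⋃ k ∈ Finset.range N, (cell k ∩ S)) := measure_mono hcov
    _ ≤ ∑ k ∈ Finset.range N, volume (cell k ∩ S) := measure_biUnion_finset_le _ _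
    _ ≤ ∑ k ∈ Finset.range N, ENNReal.ofReal ((if k ∈ bad then 1 / (N : ℝ) else 0) + η) := by
        refine Finset.sum_le_sum fun k hk => ?_
        split_ifs with hkb
        · exact (hbadvol k).trans (ENNReal.ofReal_le_ofReal (by linarith))
        · rw [zero_add]; exact hgoodvol k hk hkb
    _ = ENNReal.ofReal (∑ k ∈ Finset.range N, ((if k ∈ bad then 1 / (N : ℝ) else 0) + η)) := by
        rw [ENNReal.ofReal_sum_of_nonneg]
        intro k _
        split_ifs <;> positivity
    _ ≤ _ := by
        apply ENNReal.ofReal_le_ofReal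
        have hbs : bad ⊆ Finset.range N := Finset.filter_subset _ _
        rw [Finset.sum_add_distrib, Finset.sum_ite_mem, Finset.inter_eq_right.2 hbs,
          Finset.sum_const, Finset.sum_const, nsmul_eq_mul, nsmul_eq_mul, Finset.card_range]
        have h1 : (bad.card : ℝ) * (1 / N) ≤ 2 ^ r * (T + 2) / q := by
          calc (bad.card : ℝ) * (1 / N) ≤ 2 ^ r * (T * N / q + 2) * (1 / N) := by gcongr
            _ = 2 ^ r * (T / q + 2 / N) := by field_simp
            _ ≤ 2 ^ r * (T / q + 2 / q) := by
                gcongr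
                linarith
            _ = _ := by ring
        have h2 : (N : ℝ) * η ≤ (8 * B + 4 / a₀) / q := by
          have hqq : q ^ 2 ≤ q ^ (2 * r) := pow_le_pow_right₀ hq (by omega)
          calc (N : ℝ) * η ≤ (4 * (B * A) + 2 * q) * (2 / (q ^ 2 * A)) := by
                rw [hη]; gcongr
            _ = (8 * B + 4 / A * q) / q ^ 2 := by field_simp; ring
            _ ≤ (8 * B * q + 4 / a₀ * q) / q ^ 2 := by
                have : 8 * B ≤ 8 * B * q := by nlinarith
                gcongr
            _ = _ := by field_simp
        have h3 : 0 ≤ (Q + 2) / q := by positivity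
        have h4 : (Q + 2 + (2 ^ r * (T + 2) + 8 * B + 4 / a₀)) / q
            = (Q + 2) / q + (2 ^ r * (T + 2) / q + (8 * B + 4 / a₀) / q) := by ring
        linarith

/-! ### Weyl sums along a one-parameter flow -/

/-- The modulus of the normalized Weyl sum `(1 / S) ∑ s ∈ [1, S], exp (2 π i s x)`. -/
noncomputable def weylMean (S : ℕ) (x : ℝ) : ℝ :=
  ‖∑ s ∈ Finset.Icc 1 S, Complex.exp (2 * Real.pi * Complex.I * (s * x : ℝ))‖ / S

lemma weylMean_nonneg (S : ℕ) (x : ℝ) : 0 ≤ weylMean S x := by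
  unfold weylMean; positivity

lemma norm_exp_two_pi_I_mul (x : ℝ) : ‖Complex.exp (2 * Real.pi * Complex.I * (x : ℝ))‖ = 1 := by
  rw [show (2 * Real.pi * Complex.I * (x : ℝ) : ℂ) = ((2 * Real.pi * x : ℝ) : ℂ) * Complex.I by
    push_cast; ring]
  exact Complex.norm_exp_ofReal_mul_I _

lemma weylMean_le_one (S : ℕ) (x : ℝ) : weylMean S x ≤ 1 := by
  unfold weylMean
  apply div_le_one_of_le₀ _ (Nat.cast_nonneg _)
  refine (norm_sum_le _ _).trans ?_
  simp only [norm_exp_two_pi_I_mul]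
  simp

lemma continuous_weylMean (S : ℕ) : Continuous (weylMean S) := by
  unfold weylMean; fun_prop

lemma four_mul_abs_sub_round_le (x : ℝ) :
    4 * |x - round x| ≤ ‖Complex.exp (2 * Real.pi * Complex.I * (x : ℝ)) - 1‖ := by
  have h1 : Complex.exp (2 * Real.pi * Complex.I * (x : ℝ))
      = Complex.exp (Complex.I * ((2 * Real.pi * (x - round x) : ℝ) : ℂ)) := by
    rw [← (Complex.exp_periodic.int_mul (-(round x))) (2 * Real.pi * Complex.I * (x : ℝ))]
    congr 1
    push_cast; ring
  rw [h1, Complex.norm_exp_I_mul_ofReal_sub_one]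
  set y := x - round x with hy
  have hy2 : |y| ≤ 1 / 2 := abs_sub_round x
  have h2 : |Real.pi * y| ≤ Real.pi / 2 := by
    rw [abs_mul, abs_of_pos Real.pi_pos]; nlinarith [Real.pi_pos]
  have h3 := Real.mul_abs_le_abs_sin h2
  rw [abs_mul, abs_of_pos Real.pi_pos, ← mul_assoc, div_mul_cancel₀ _ Real.pi_pos.ne'] at h3
  rw [show 2 * Real.pi * y / 2 = Real.pi * y by ring, norm_mul, Real.norm_eq_abs, Real.norm_eq_abs,
    abs_of_pos (by norm_num : (0 : ℝ) < 2)]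
  linarith

lemma norm_sum_exp_mul_abs_sub_round_le (S : ℕ) (x : ℝ) :
    ‖∑ s ∈ Finset.Icc 1 S, Complex.exp (2 * Real.pi * Complex.I * (s * x : ℝ))‖ * |x - round x|
      ≤ 1 := by
  set z := Complex.exp (2 * Real.pi * Complex.I * (x : ℝ)) with hz
  have hz1 : ‖z‖ = 1 := norm_exp_two_pi_I_mul x
  have hpow : ∀ s : ℕ, Complex.exp (2 * Real.pi * Complex.I * (s * x : ℝ)) = z ^ s := by
    intro s
    rw [hz, ← Complex.exp_nat_mul]; congr 1; push_cast; ring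
  have hsum : (∑ s ∈ Finset.Icc 1 S, z ^ s) * (z - 1) = z ^ (S + 1) - z := by
    rw [show Finset.Icc 1 S = Finset.Ico 1 (S + 1) by ext; simp]
    have := geom_sum_Ico_mul z (show 1 ≤ S + 1 by omega)
    simpa using this
  have hle : ‖∑ s ∈ Finset.Icc 1 S, z ^ s‖ * ‖z - 1‖ ≤ 2 := by
    rw [← norm_mul, hsum]
    refine (norm_sub_le _ _).trans ?_
    rw [norm_pow, hz1]; norm_num
  have h4 := four_mul_abs_sub_round_le x
  rw [← hz] at h4
  simp only [hpow]
  nlinarith [norm_nonneg (∑ s ∈ Finset.Icc 1 S, z ^ s), abs_nonneg (x - round x)]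

/-- For `X, v : ι → ℝ` with integral `v`, the average of a nontrivial Weyl sum at the point
`∑ M i * b i ^ ({X i + t v i} - 1)` over the closed orbit `t ∈ [0, 1]` saves a power of the length,
uniformly in the frequency `M` and the base point `X`. The fractional parts are resolved by splitting
according to the values of the finitely many possible integer parts. -/
lemma exists_integral_weylMean_le {ι : Type*} [Fintype ι] [Nonempty ι] (b : ι → ℝ)
    (hb : ∀ i, 1 < b i) (v : ι → ℤ) (hv : ∀ i, v i ≠ 0)
    (hinj : Function.Injective fun i => (v i : ℝ) * Real.log (b i)) :
    ∃ C : ℝ, 0 < C ∧ ∀ M : ι → ℤ, M ≠ 0 → ∀ X : ι → ℝ, ∀ q : ℝ, 1 ≤ q → ∀ S : ℕ,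
      q ^ (4 * Fintype.card ι) ≤ S →
      ∫ t in (0 : ℝ)..1, weylMean S (∑ i, M i * b i ^ (Int.fract (X i + t * v i) - 1)) ≤ C / q := by
  classical
  obtain ⟨i₀, hi₀⟩ := Finite.exists_min fun i => b i ^ (-(|(v i : ℝ)| + 2))
  obtain ⟨C, hC, hvol⟩ := exists_volume_near_int_le (fun i => (v i : ℝ) * Real.log (b i)) hinj
    (fun i => mul_ne_zero (Int.cast_ne_zero.2 (hv i)) (Real.log_pos (hb i)).ne')
    (a₀ := b i₀ ^ (-(|(v i₀ : ℝ)| + 2))) (Real.rpow_pos_of_pos (by linarith [hb i₀]) _)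
  set K : Finset (ι → ℤ) := Fintype.piFinset fun i => Finset.Icc (-(|v i| + 1)) (|v i| + 1) with hK
  refine ⟨K.card * C + 1, by positivity, ?_⟩
  intro M hM X q hq S hS
  set r := Fintype.card ι with hr
  have hrpos : 0 < r := Fintype.card_pos
  have hq0 : 0 < q := by linarith
  have hS0 : (0 : ℝ) < S := lt_of_lt_of_le (by positivity) hS
  set g : ℝ → ℝ := fun t => ∑ i, M i * b i ^ (Int.fract (X i + t * v i) - 1) with hg
  have hgm : Measurable g := by
    refine Finset.measurable_sum _ fun i _ => ?_
    refine Measurable.const_mul ?_ _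
    refine measurable_const.pow ?_
    fun_prop
  set δ : ℝ := 1 / q ^ (3 * r) with hδ
  have hδ0 : 0 < δ := by positivity
  set E : Set ℝ := {t : ℝ | t ∈ Set.Ioc (0 : ℝ) 1 ∧ |g t - round (g t)| < δ} with hE
  have hrm : Measurable fun x : ℝ => |x - round x| := by
    have : (fun x : ℝ => |x - round x|) = fun x : ℝ => |x - ((⌊x + 1 / 2⌋ : ℤ) : ℝ)| := by
      ext x; rw [round_eq]
    rw [this]
    have h1 : Measurable fun x : ℝ => ((⌊x + 1 / 2⌋ : ℤ) : ℝ) := by fun_prop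
    exact (measurable_id.sub h1).abs
  have hEm : MeasurableSet E :=
    measurableSet_Ioc.inter (measurableSet_lt (hrm.comp hgm) measurable_const)
  have hEsub : E ⊆ ⋃ k ∈ K, {t : ℝ | t ∈ Set.Ioc (0 : ℝ) 1 ∧
      |(∑ i, (M i * b i ^ (Int.fract (X i) - k i - 1)) * Real.exp ((v i * Real.log (b i)) * t)) -
        round (∑ i, (M i * b i ^ (Int.fract (X i) - k i - 1)) *
          Real.exp ((v i * Real.log (b i)) * t))| < δ} := by
    intro t ht
    simp only [Set.mem_iUnion]
    refine ⟨fun i => ⌊X i + t * v i⌋ - ⌊X i⌋, ?_, ht.1, ?_⟩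
    · rw [hK, Fintype.mem_piFinset]
      intro i
      have ht0 := ht.1.1
      have ht1 := ht.1.2
      have h1 : |t * (v i : ℝ)| ≤ |(v i : ℝ)| := by
        rw [abs_mul, abs_of_pos ht0]; nlinarith [abs_nonneg (v i : ℝ)]
      have h1' := abs_le.1 h1
      have h2 := Int.floor_le (X i + t * v i)
      have h3 := Int.lt_floor_add_one (X i + t * v i)
      have h4 := Int.floor_le (X i)
      have h5 := Int.lt_floor_add_one (X i)
      have e1 : (⌊X i + t * v i⌋ : ℝ) - ⌊X i⌋ < |(v i : ℝ)| + 1 := by linarith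
      have e2 : -(|(v i : ℝ)| + 1) < (⌊X i + t * v i⌋ : ℝ) - ⌊X i⌋ := by linarith
      rw [Finset.mem_Icc]
      constructor
      · have : -(|v i| + 1) < ⌊X i + t * v i⌋ - ⌊X i⌋ := by exact_mod_cast e2
        omega
      · have : ⌊X i + t * v i⌋ - ⌊X i⌋ < |v i| + 1 := by exact_mod_cast e1
        omega
    · have heq : (∑ i, (M i * b i ^ (Int.fract (X i) - (⌊X i + t * v i⌋ - ⌊X i⌋ : ℤ) - 1)) *
          Real.exp ((v i * Real.log (b i)) * t)) = g t := by
        refine Finset.sum_congr rfl fun i _ => ?_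
        have hb0 : 0 < b i := by linarith [hb i]
        rw [Real.rpow_def_of_pos hb0, Real.rpow_def_of_pos hb0, mul_assoc, ← Real.exp_add]
        congr 2
        simp only [Int.fract]
        push_cast; ring
      rw [heq]; exact ht.2
  have hEvol : volume E ≤ ENNReal.ofReal (K.card * C / q) := by
    obtain ⟨i₁, hi₁⟩ : ∃ i, M i ≠ 0 := by
      by_contra hcon; push Not at hcon; exact hM (funext hcon)
    calc volume E ≤ _ := measure_mono hEsub
      _ ≤ _ := measure_biUnion_finset_le _ _
      _ ≤ ∑ k ∈ K, ENNReal.ofReal (C / q) := by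
          refine Finset.sum_le_sum fun k hk => ?_
          refine hvol (fun i => M i * b i ^ (Int.fract (X i) - k i - 1)) ⟨i₁, ?_⟩ q hq
          refine (hi₀ i₁).trans ?_
          have hb0 : 0 < b i₁ := by linarith [hb i₁]
          rw [abs_mul, abs_of_pos (Real.rpow_pos_of_pos hb0 _)]
          have h1 : (1 : ℝ) ≤ |(M i₁ : ℝ)| := by exact_mod_cast Int.one_le_abs hi₁
          have h2 : b i₁ ^ (-(|(v i₁ : ℝ)| + 2)) ≤ b i₁ ^ (Int.fract (X i₁) - k i₁ - 1) := by
            apply Real.rpow_le_rpow_of_exponent_le (hb i₁).le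
            have h3 := (Finset.mem_Icc.1 ((Fintype.mem_piFinset.1 hk) i₁)).2
            have h4 : (k i₁ : ℝ) ≤ |(v i₁ : ℝ)| + 1 := by exact_mod_cast h3
            linarith [Int.fract_nonneg (X i₁)]
          have h5 := Real.rpow_pos_of_pos hb0 (Int.fract (X i₁) - k i₁ - 1)
          nlinarith
      _ = ENNReal.ofReal (K.card * C / q) := by
          rw [← ENNReal.ofReal_sum_of_nonneg (fun _ _ => by positivity), Finset.sum_const,
            nsmul_eq_mul]
          congr 1; ring
  have hpt : ∀ t ∈ Set.Ioc (0 : ℝ) 1, weylMean S (g t) ≤ E.indicator 1 t + 1 / q := by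
    intro t ht
    by_cases htE : t ∈ E
    · rw [Set.indicator_of_mem htE]
      have := weylMean_le_one S (g t)
      have : 0 ≤ 1 / q := by positivity
      simp only [Pi.one_apply]; linarith
    · rw [Set.indicator_of_notMem htE, zero_add]
      have hge : δ ≤ |g t - round (g t)| := by
        by_contra hcon; exact htE ⟨ht, not_le.1 hcon⟩
      have h1 := norm_sum_exp_mul_abs_sub_round_le S (g t)
      unfold weylMean
      set Z := ‖∑ s ∈ Finset.Icc 1 S, Complex.exp (2 * Real.pi * Complex.I * (s * g t : ℝ))‖
      have hZ : 0 ≤ Z := norm_nonneg _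
      have h2 : Z * δ ≤ 1 := (mul_le_mul_of_nonneg_left hge hZ).trans h1
      have h3 : Z ≤ q ^ (3 * r) := by
        rw [hδ, mul_one_div, div_le_one (by positivity)] at h2; exact h2
      rw [div_le_div_iff₀ hS0 hq0]
      calc Z * q ≤ q ^ (3 * r) * q ^ r := by
            gcongr
            exact le_self_pow₀ hq hrpos.ne'
        _ = q ^ (4 * r) := by rw [← pow_add]; ring_nf
        _ ≤ 1 * S := by linarith
  have hEfin : volume E ≠ ⊤ := ne_top_of_le_ne_top ENNReal.ofReal_ne_top hEvol
  have hint1 : IntegrableOn (fun t => weylMean S (g t)) (Set.Ioc 0 1) := by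
    refine Measure.integrableOn_of_bounded (M := 1) (by simp)
      ((continuous_weylMean S).measurable.comp hgm).aestronglyMeasurable ?_
    refine Filter.Eventually.of_forall fun t => ?_
    rw [Real.norm_eq_abs, abs_of_nonneg (weylMean_nonneg _ _)]
    exact weylMean_le_one _ _
  have hind : Integrable (E.indicator (1 : ℝ → ℝ)) :=
    (integrable_indicator_iff hEm).2 (integrableOn_const hEfin)
  have hint2 : IntegrableOn (fun t => E.indicator (1 : ℝ → ℝ) t + 1 / q) (Set.Ioc 0 1) :=
    hind.integrableOn.add (integrableOn_const (by simp))
  rw [intervalIntegral.integral_of_le zero_le_one]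
  calc ∫ t in Set.Ioc (0 : ℝ) 1, weylMean S (g t)
      ≤ ∫ t in Set.Ioc (0 : ℝ) 1, (E.indicator (1 : ℝ → ℝ) t + 1 / q) :=
        setIntegral_mono_on hint1 hint2 measurableSet_Ioc hpt
    _ = (∫ t in Set.Ioc (0 : ℝ) 1, E.indicator (1 : ℝ → ℝ) t) + 1 / q := by
        rw [integral_add hind.integrableOn (integrableOn_const (by simp))]
        simp
    _ ≤ (∫ t, E.indicator (1 : ℝ → ℝ) t) + 1 / q := by
        refine add_le_add (setIntegral_le_integral hind ?_) le_rfl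
        exact Filter.Eventually.of_forall fun t => Set.indicator_nonneg (fun _ _ => zero_le_one) t
    _ = (volume E).toReal + 1 / q := by
        rw [integral_indicator_one hEm]; rfl
    _ ≤ K.card * C / q + 1 / q := by
        gcongr
        exact ENNReal.toReal_le_of_le_ofReal (by positivity) hEvol
    _ = _ := by ring

/-! ### Equidistribution of torus rotations modulo a flow -/

/-- If no `θ i` is rational, some integral direction with nonzero coordinates annihilates every
integral linear relation of the `θ i` modulo `1`. -/
lemma exists_direction {ι : Type*} [Fintype ι] (θ : ι → ℝ) (hθ : ∀ i, Irrational (θ i)) :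
    ∃ v : ι → ℤ, (∀ i, v i ≠ 0) ∧
      ∀ k : ι → ℤ, (∃ m : ℤ, ∑ i, (k i : ℝ) * θ i = m) → ∑ i, k i * v i = 0 := by
  classical
  set R : Submodule ℚ (ι → ℚ) :=
    (LinearMap.range (Algebra.linearMap ℚ ℝ)).comap (Fintype.linearCombination ℚ θ) with hR
  have hmem : ∀ k : ι → ℚ, k ∈ R ↔ ∃ c : ℚ, (c : ℝ) = ∑ i, (k i : ℝ) * θ i := by
    intro k
    rw [hR, Submodule.mem_comap, LinearMap.mem_range, Fintype.linearCombination_apply]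
    simp [Rat.smul_def]
  obtain ⟨f, hf⟩ := Module.exists_dual_forall_apply_ne_zero (K := ℚ)
    (fun i : ι => R.mkQ (Pi.single i 1)) (by
      intro i hi
      rw [Submodule.mkQ_apply, Submodule.Quotient.mk_eq_zero, hmem] at hi
      obtain ⟨c, hc⟩ := hi
      rw [Finset.sum_eq_single i (by intro j _ hj; simp [Pi.single_eq_of_ne hj]) (by simp)] at hc
      simp only [Pi.single_eq_same, Rat.cast_one, one_mul] at hc
      exact hθ i ⟨c, hc⟩)
  set φ : ι → ℚ := fun i => f (R.mkQ (Pi.single i 1)) with hφ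
  have hann : ∀ k : ι → ℚ, k ∈ R → ∑ i, k i * φ i = 0 := by
    intro k hk
    have h0 : f (R.mkQ k) = 0 := by
      rw [Submodule.mkQ_apply, (Submodule.Quotient.mk_eq_zero R).2 hk, map_zero]
    have hk' : k = ∑ i, k i • (Pi.single i 1 : ι → ℚ) := by
      ext j; simp [Finset.sum_apply, Pi.single_apply]
    rw [← h0]
    conv_rhs => rw [hk']
    rw [map_sum, map_sum]
    exact Finset.sum_congr rfl fun i _ => by rw [map_smul, map_smul, smul_eq_mul]
  obtain ⟨d, hd⟩ := IsLocalization.exist_integer_multiples_of_finite (nonZeroDivisors ℤ) φ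
  choose v hv using hd
  have hd0 : (d : ℤ) ≠ 0 := nonZeroDivisors.coe_ne_zero d
  have hv' : ∀ i, (v i : ℚ) = (d : ℤ) * φ i := by
    intro i
    have := hv i
    simpa using this
  refine ⟨v, fun i hi => ?_, fun k hk => ?_⟩
  · have := hv' i
    rw [hi, Int.cast_zero] at this
    exact (mul_ne_zero (Int.cast_ne_zero.2 hd0) (hf i)) this.symm
  · obtain ⟨m, hm⟩ := hk
    have h1 := hann (fun i => (k i : ℚ)) ((hmem _).2 ⟨m, by push_cast; exact hm.symm⟩)
    have h2 : ((∑ i, k i * v i : ℤ) : ℚ) = 0 := by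
      push_cast
      calc ∑ i, (k i : ℚ) * v i = (d : ℤ) * ∑ i, (k i : ℚ) * φ i := by
            rw [Finset.mul_sum]
            exact Finset.sum_congr rfl fun i _ => by rw [hv']; ring
        _ = 0 := by rw [h1, mul_zero]
    exact_mod_cast h2

/-- The point of the torus with real coordinates `X`. -/
def torusPoint {ι : Type*} (X : ι → ℝ) : UnitAddTorus ι := fun i => (X i : UnitAddCircle)

lemma continuous_torusPoint {ι : Type*} : Continuous (torusPoint (ι := ι)) :=
  continuous_pi fun i => (AddCircle.continuous_mk' 1).comp (continuous_apply i)

lemma mFourier_torusPoint {ι : Type*} [Fintype ι] (k : ι → ℤ) (X : ι → ℝ) :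
    UnitAddTorus.mFourier k (torusPoint X)
      = Complex.exp (2 * Real.pi * Complex.I * ((∑ i, k i * X i : ℝ))) := by
  simp only [UnitAddTorus.mFourier, ContinuousMap.coe_mk, torusPoint]
  rw [Complex.ofReal_sum, Finset.mul_sum, Complex.exp_sum]
  refine Finset.prod_congr rfl fun i _ => ?_
  rw [fourier_coe_apply]
  congr 1
  push_cast; ring

/-- The value of `Φ` at a point of the rotation by `θ`, minus its average over the closed orbit of
that point in the direction `v`. -/
noncomputable def flowDefect {ι : Type*} (θ : ι → ℝ) (v : ι → ℤ)
    (Φ : C(UnitAddTorus ι, ℂ)) (n : ℕ) : ℂ :=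
  Φ (torusPoint fun i => n * θ i) - ∫ t in (0 : ℝ)..1, Φ (torusPoint fun i => n * θ i + t * v i)

lemma continuous_flow {ι : Type*} (X : ι → ℝ) (v : ι → ℤ) :
    Continuous fun t : ℝ => torusPoint fun i => X i + t * v i :=
  continuous_torusPoint.comp (by fun_prop)

lemma flowDefect_add {ι : Type*} (θ : ι → ℝ) (v : ι → ℤ)
    (Φ Ψ : C(UnitAddTorus ι, ℂ)) (n : ℕ) :
    flowDefect θ v (Φ + Ψ) n = flowDefect θ v Φ n + flowDefect θ v Ψ n := by
  unfold flowDefect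
  simp only [ContinuousMap.add_apply]
  rw [intervalIntegral.integral_add]
  · ring
  · exact (Φ.continuous.comp (continuous_flow _ v)).intervalIntegrable _ _
  · exact (Ψ.continuous.comp (continuous_flow _ v)).intervalIntegrable _ _

lemma flowDefect_smul {ι : Type*} (θ : ι → ℝ) (v : ι → ℤ) (c : ℂ)
    (Φ : C(UnitAddTorus ι, ℂ)) (n : ℕ) :
    flowDefect θ v (c • Φ) n = c * flowDefect θ v Φ n := by
  unfold flowDefect
  simp only [ContinuousMap.smul_apply, smul_eq_mul, intervalIntegral.integral_const_mul]
  ring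

lemma norm_flowDefect_le {ι : Type*} [Fintype ι] (θ : ι → ℝ) (v : ι → ℤ)
    (Φ : C(UnitAddTorus ι, ℂ)) (n : ℕ) : ‖flowDefect θ v Φ n‖ ≤ 2 * ‖Φ‖ := by
  unfold flowDefect
  have h1 := Φ.norm_coe_le_norm (torusPoint fun i => n * θ i)
  have h2 := intervalIntegral.norm_integral_le_of_norm_le_const (a := 0) (b := 1)
    (f := fun t : ℝ => Φ (torusPoint fun i => n * θ i + t * v i)) (C := ‖Φ‖)
    (fun t _ => Φ.norm_coe_le_norm _)
  rw [sub_zero, abs_one, mul_one] at h2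
  refine (norm_sub_le _ _).trans ?_
  linarith

lemma flowDefect_mFourier {ι : Type*} [Fintype ι] (θ : ι → ℝ) (v : ι → ℤ) (k : ι → ℤ) (n : ℕ) :
    flowDefect θ v (UnitAddTorus.mFourier k) n = if ∑ i, k i * v i = 0 then 0 else
      Complex.exp (2 * Real.pi * Complex.I * (n * (∑ i, k i * θ i) : ℝ)) := by
  unfold flowDefect
  simp only [mFourier_torusPoint]
  set m : ℤ := ∑ i, k i * v i with hm
  have h1 : ∀ t : ℝ, ∑ i, (k i : ℝ) * (n * θ i + t * v i)
      = n * (∑ i, k i * θ i) + t * m := by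
    intro t
    rw [hm]; push_cast
    rw [Finset.mul_sum, Finset.mul_sum, ← Finset.sum_add_distrib]
    exact Finset.sum_congr rfl fun i _ => by ring
  have h2 : ∑ i, (k i : ℝ) * (n * θ i) = n * (∑ i, k i * θ i) := by
    have := h1 0; simpa using this
  simp only [h1, h2]
  split_ifs with h
  · rw [h]; simp
  · have h3 : ∀ t : ℝ, Complex.exp (2 * Real.pi * Complex.I * (n * (∑ i, k i * θ i) + t * m : ℝ))
        = Complex.exp (2 * Real.pi * Complex.I * (n * (∑ i, k i * θ i) : ℝ)) *
          Complex.exp ((2 * Real.pi * Complex.I * m) * t) := by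
      intro t
      rw [← Complex.exp_add]; congr 1; push_cast; ring
    have hne : (2 * Real.pi * Complex.I * m : ℂ) ≠ 0 :=
      mul_ne_zero Complex.two_pi_I_ne_zero (Int.cast_ne_zero.2 h)
    have h4 : Complex.exp (2 * Real.pi * Complex.I * m) = 1 := by
      rw [mul_comm]; exact Complex.exp_int_mul_two_pi_mul_I m
    simp only [h3]
    rw [intervalIntegral.integral_const_mul, integral_exp_mul_complex hne]
    simp [h4]

/-- Weyl's criterion relative to the flow in the direction `v`: the characters trivial on the flow
have zero defect, and all others are nontrivial on the rotation by `θ`. -/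
lemma tendsto_average_flowDefect {ι : Type*} [Fintype ι] (θ : ι → ℝ) (v : ι → ℤ)
    (h : ∀ k : ι → ℤ, (∃ m : ℤ, ∑ i, (k i : ℝ) * θ i = m) → ∑ i, k i * v i = 0)
    (Φ : C(UnitAddTorus ι, ℂ)) :
    Tendsto (fun N : ℕ => (∑ n ∈ Finset.Icc 1 N, flowDefect θ v Φ n) / N) atTop (𝓝 0) := by
  have hspan : ∀ Ψ ∈ Submodule.span ℂ (Set.range (UnitAddTorus.mFourier (d := ι))),
      Tendsto (fun N : ℕ => (∑ n ∈ Finset.Icc 1 N, flowDefect θ v Ψ n) / N) atTop (𝓝 0) := by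
    intro Ψ hΨ
    induction hΨ using Submodule.span_induction with
    | mem x hx =>
      obtain ⟨k, rfl⟩ := hx
      simp only [flowDefect_mFourier]
      split_ifs with hk
      · simp
      set y : ℝ := ∑ i, k i * θ i with hy
      have hy0 : 0 < |y - round y| := by
        rw [abs_pos, sub_ne_zero]
        exact fun hcon => hk (h k ⟨round y, hcon⟩)
      refine squeeze_zero_norm (a := fun N : ℕ => (1 / |y - round y|) / N) (fun N => ?_)
        (tendsto_const_div_atTop_nhds_zero_nat _)
      rw [norm_div, Complex.norm_natCast]
      gcongr
      rw [le_div_iff₀ hy0]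
      exact norm_sum_exp_mul_abs_sub_round_le N y
    | zero =>
      have : ∀ n, flowDefect θ v 0 n = 0 := by intro n; simp [flowDefect]
      simp [this]
    | add x y _ _ hx hy =>
      simp only [flowDefect_add, Finset.sum_add_distrib, add_div]
      simpa using hx.add hy
    | smul c x _ hx =>
      simp only [flowDefect_smul, ← Finset.mul_sum, mul_div_assoc]
      simpa using hx.const_mul c
  rw [Metric.tendsto_atTop]
  intro ε hε
  have hcl : Φ ∈ (Submodule.span ℂ (Set.range (UnitAddTorus.mFourier (d := ι)))).topologicalClosure := by
    rw [UnitAddTorus.span_mFourier_closure_eq_top]; trivial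
  obtain ⟨Ψ, hΨ, hdist⟩ := Metric.mem_closure_iff.1 hcl (ε / 4) (by positivity)
  obtain ⟨N₀, hN₀⟩ := Metric.tendsto_atTop.1 (hspan Ψ hΨ) (ε / 2) (by positivity)
  refine ⟨N₀, fun N hN => ?_⟩
  have h1 := hN₀ N hN
  rw [dist_zero_right] at h1 ⊢
  have h2 : ∀ n, flowDefect θ v Φ n = flowDefect θ v (Φ - Ψ) n + flowDefect θ v Ψ n := by
    intro n; rw [← flowDefect_add]; congr 1; abel
  simp only [h2, Finset.sum_add_distrib, add_div]
  have h3 : ‖(∑ n ∈ Finset.Icc 1 N, flowDefect θ v (Φ - Ψ) n) / (N : ℂ)‖ ≤ ε / 2 := by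
    rw [norm_div, Complex.norm_natCast]
    refine div_le_of_le_mul₀ (Nat.cast_nonneg _) (by positivity) ?_
    calc ‖∑ n ∈ Finset.Icc 1 N, flowDefect θ v (Φ - Ψ) n‖
        ≤ ∑ n ∈ Finset.Icc 1 N, ‖flowDefect θ v (Φ - Ψ) n‖ := norm_sum_le _ _
      _ ≤ ∑ _n ∈ Finset.Icc 1 N, ε / 2 := by
          refine Finset.sum_le_sum fun n _ => (norm_flowDefect_le θ v _ n).trans ?_
          rw [dist_eq_norm] at hdist
          linarith
      _ = ε / 2 * N := by simp [mul_comm]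
  calc _ ≤ _ := norm_add_le _ _
    _ < ε := by linarith

/-- A continuous function on the torus whose averages over all closed orbits in the direction `v` are
at most `B` has asymptotic average at most `B` along the rotation by `θ`. -/
lemma eventually_sum_le_of_flow_average_le {ι : Type*} [Fintype ι] (θ : ι → ℝ) (v : ι → ℤ)
    (h : ∀ k : ι → ℤ, (∃ m : ℤ, ∑ i, (k i : ℝ) * θ i = m) → ∑ i, k i * v i = 0)
    (Ψ : C(UnitAddTorus ι, ℝ)) {B : ℝ}
    (hB : ∀ X : ι → ℝ, ∫ t in (0 : ℝ)..1, Ψ (torusPoint fun i => X i + t * v i) ≤ B)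
    {ε : ℝ} (hε : 0 < ε) :
    ∀ᶠ N : ℕ in atTop, ∑ n ∈ Finset.Icc 1 N, Ψ (torusPoint fun i => n * θ i) ≤ (B + ε) * N := by
  set Φ : C(UnitAddTorus ι, ℂ) := ⟨fun x => (Ψ x : ℂ), by fun_prop⟩ with hΦ
  have hd : ∀ n, flowDefect θ v Φ n = ((Ψ (torusPoint fun i => n * θ i) -
      ∫ t in (0 : ℝ)..1, Ψ (torusPoint fun i => n * θ i + t * v i) : ℝ) : ℂ) := by
    intro n
    simp only [flowDefect, hΦ, ContinuousMap.coe_mk]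
    rw [intervalIntegral.integral_ofReal]; push_cast; rfl
  obtain ⟨N₀, hN₀⟩ := Metric.tendsto_atTop.1 (tendsto_average_flowDefect θ v h Φ) ε hε
  filter_upwards [eventually_ge_atTop N₀, eventually_ge_atTop 1] with N hN hN1
  have h1 := hN₀ N hN
  have hNR : (0 : ℝ) < N := by exact_mod_cast hN1
  rw [dist_zero_right, norm_div, Complex.norm_natCast, div_lt_iff₀ hNR] at h1
  simp only [hd] at h1
  rw [← Complex.ofReal_sum, Complex.norm_real, Real.norm_eq_abs, Finset.sum_sub_distrib] at h1
  have h2 := (abs_lt.1 h1).2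
  have h3 : ∑ n ∈ Finset.Icc 1 N, ∫ t in (0 : ℝ)..1, Ψ (torusPoint fun i => n * θ i + t * v i)
      ≤ B * N := by
    calc _ ≤ ∑ _n ∈ Finset.Icc 1 N, B := Finset.sum_le_sum fun n _ => hB _
      _ = B * N := by simp [mul_comm]
  linarith

/-- A continuous function on the circle that agrees with `b ^ ({y} - 1)` at distance at least `η`
from the jump at the integers. -/
lemma exists_continuous_eq_rpow_fract (b : ℝ) (hb : 1 < b) {η : ℝ} (hη : 0 < η) :
    ∃ A : C(UnitAddCircle, ℝ), ∀ y : ℝ, η ≤ ‖(y : UnitAddCircle)‖ →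
      A (y : UnitAddCircle) = b ^ (Int.fract y - 1) := by
  have hb0 : 0 < b := by linarith
  have hinv : b⁻¹ ≤ 1 := inv_le_one_of_one_le₀ hb.le
  set h : ℝ → ℝ := fun t => min (b ^ (t - 1)) (b⁻¹ + (1 - t) / η) with hh
  have hcont : Continuous h := by
    have h1 : Continuous fun t : ℝ => b ^ (t - 1) :=
      continuous_const.rpow (by fun_prop) (fun _ => Or.inl hb0.ne')
    fun_prop
  have h01 : h 0 = h 1 := by
    have h1 : (0 : ℝ) ≤ (1 - 0) / η := by positivity
    simp only [hh]
    rw [zero_sub, Real.rpow_neg_one, min_eq_left (by linarith), sub_self, Real.rpow_zero,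
      zero_div, add_zero, min_eq_right hinv]
  refine ⟨⟨AddCircle.liftIco 1 0 h, AddCircle.liftIco_zero_continuous h01 hcont.continuousOn⟩, ?_⟩
  intro y hy
  have hyf : (y : UnitAddCircle) = ((Int.fract y : ℝ) : UnitAddCircle) := by
    rw [← Int.self_sub_floor, AddCircle.coe_sub]
    have : ((⌊y⌋ : ℝ) : UnitAddCircle) = 0 := AddCircle.coe_eq_zero_iff 1 |>.2 ⟨⌊y⌋, by simp⟩
    rw [this, sub_zero]
  rw [ContinuousMap.coe_mk, hyf, AddCircle.liftIco_coe_apply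
    ⟨Int.fract_nonneg y, by rw [zero_add]; exact Int.fract_lt_one y⟩]
  simp only [hh]
  apply min_eq_left
  have h1 : η ≤ 1 - Int.fract y := by
    rw [UnitAddCircle.norm_eq] at hy
    have h2 := round_le y (⌊y⌋ + 1)
    have h3 : |y - ((⌊y⌋ + 1 : ℤ) : ℝ)| = 1 - Int.fract y := by
      have h4 : y - ((⌊y⌋ + 1 : ℤ) : ℝ) = -(1 - Int.fract y) := by
        rw [← Int.self_sub_floor]; push_cast; ring
      rw [h4, abs_neg, abs_of_pos (by linarith [Int.fract_lt_one y])]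
    linarith
  have h2 : 1 ≤ (1 - Int.fract y) / η := (one_le_div hη).2 h1
  have h3 : b ^ (Int.fract y - 1) ≤ 1 :=
    Real.rpow_le_one_of_one_le_of_nonpos hb.le (by linarith [Int.fract_lt_one y])
  have h4 : 0 < b⁻¹ := inv_pos.2 hb0
  linarith

/-- A tent on the circle of height `2` that is at least `1` at distance at most `η` from `0`. -/
noncomputable def circleBump (η : ℝ) : C(UnitAddCircle, ℝ) :=
  ⟨fun x => max 0 (2 - ‖x‖ / η), by fun_prop⟩

lemma circleBump_nonneg (η : ℝ) (x : UnitAddCircle) : 0 ≤ circleBump η x := le_max_left _ _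

lemma one_le_circleBump {η : ℝ} (hη : 0 < η) {x : UnitAddCircle} (hx : ‖x‖ ≤ η) :
    1 ≤ circleBump η x := by
  refine le_trans ?_ (le_max_right _ _)
  have := (div_le_one hη).2 hx
  linarith

lemma integral_circleBump_flow_le {η : ℝ} (hη : 0 < η) (X : ℝ) {v : ℤ} (hv : v ≠ 0) :
    ∫ t in (0 : ℝ)..1, circleBump η ((X + t * v : ℝ) : UnitAddCircle) ≤ 8 * η := by
  set u : ℝ → ℝ := fun y => circleBump η (y : UnitAddCircle) with hu
  have huc : Continuous u := (circleBump η).continuous.comp (AddCircle.continuous_mk' 1)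
  have hper : Function.Periodic u 1 := fun y => by simp [hu]
  have hvR : (v : ℝ) ≠ 0 := Int.cast_ne_zero.2 hv
  have h1 : ∫ t in (0 : ℝ)..1, u (X + t * v) = ∫ y in (-(1 / 2) : ℝ)..(1 / 2), u y := by
    have h2 := intervalIntegral.integral_comp_add_mul (a := 0) (b := 1) u hvR X
    simp only [mul_comm (v : ℝ)] at h2
    rw [h2]
    have h3 := hper.intervalIntegral_add_zsmul_eq v X
      (fun a b => huc.intervalIntegrable a b)
    rw [zero_mul, add_zero, one_mul]
    rw [show v • (1 : ℝ) = v by simp] at h3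
    rw [h3, hper.intervalIntegral_add_eq X (-(1 / 2)), zsmul_eq_mul, smul_eq_mul, ← mul_assoc,
      inv_mul_cancel₀ hvR, one_mul]
    norm_num
  change ∫ t in (0 : ℝ)..1, u (X + t * v) ≤ 8 * η
  rw [h1, intervalIntegral.integral_of_le (by norm_num)]
  have hind : Integrable ((Set.Icc (-(2 * η)) (2 * η)).indicator (fun _ : ℝ => (2 : ℝ))) :=
    (integrable_indicator_iff measurableSet_Icc).2 (integrableOn_const (by simp))
  calc ∫ y in Set.Ioc (-(1 / 2) : ℝ) (1 / 2), u y
      ≤ ∫ y in Set.Ioc (-(1 / 2) : ℝ) (1 / 2),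
          (Set.Icc (-(2 * η)) (2 * η)).indicator (fun _ : ℝ => (2 : ℝ)) y := by
        refine setIntegral_mono_on (huc.integrableOn_Ioc) hind.integrableOn measurableSet_Ioc ?_
        intro y hy
        have hn : ‖(y : UnitAddCircle)‖ = |y| := by
          rw [AddCircle.norm_coe_eq_abs_iff 1 one_ne_zero, abs_one]
          exact abs_le.2 ⟨hy.1.le, hy.2⟩
        by_cases hyI : y ∈ Set.Icc (-(2 * η)) (2 * η)
        · rw [Set.indicator_of_mem hyI]
          refine max_le (by norm_num) ?_
          have : 0 ≤ ‖(y : UnitAddCircle)‖ / η := by positivity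
          linarith
        · rw [Set.indicator_of_notMem hyI]
          refine max_le le_rfl ?_
          rw [hn, sub_nonpos, le_div_iff₀ hη]
          by_contra hcon
          exact hyI (abs_le.1 (not_le.1 hcon).le)
    _ ≤ ∫ y, (Set.Icc (-(2 * η)) (2 * η)).indicator (fun _ : ℝ => (2 : ℝ)) y :=
        setIntegral_le_integral hind (Filter.Eventually.of_forall fun y =>
          Set.indicator_nonneg (fun _ _ => by norm_num) y)
    _ = 8 * η := by
        rw [integral_indicator measurableSet_Icc, setIntegral_const, Measure.real, Real.volume_Icc,
          ENNReal.toReal_ofReal (by linarith), smul_eq_mul]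
        ring

lemma pow_ne_two_pow_of_odd {p a b : ℕ} (hp : p.Prime) (ho : Odd p) (ha : a ≠ 0) :
    p ^ a ≠ 2 ^ b := by
  intro h
  have h1 : p ∣ 2 ^ b := h ▸ dvd_pow_self p ha
  have h2 := (Nat.prime_dvd_prime_iff_eq hp Nat.prime_two).1 (hp.dvd_of_dvd_pow h1)
  rw [h2] at ho
  exact absurd ho (by decide)

lemma irrational_log_two_div_log {p : ℕ} (hp : p.Prime) (ho : Odd p) :
    Irrational (Real.log 2 / Real.log p) := by
  have hlp : 0 < Real.log p := Real.log_pos (by exact_mod_cast hp.one_lt)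
  have hl2 : 0 < Real.log 2 := Real.log_pos one_lt_two
  rintro ⟨c, hc⟩
  have hc0 : 0 < c := by
    have : (0 : ℝ) < c := by rw [hc]; positivity
    exact_mod_cast this
  have hnum : 0 < c.num := Rat.num_pos.2 hc0
  have h1 : (c.num : ℝ) * Real.log p = c.den * Real.log 2 := by
    rw [Rat.cast_def, div_eq_div_iff (by exact_mod_cast c.den_ne_zero) hlp.ne'] at hc
    linarith
  obtain ⟨a, ha⟩ := Int.eq_ofNat_of_zero_le hnum.le
  rw [ha, Int.cast_natCast, ← Real.log_pow, ← Real.log_pow] at h1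
  have h2 := Real.log_injOn_pos (Set.mem_Ioi.2 (by have := hp.pos; positivity))
    (Set.mem_Ioi.2 (by positivity)) h1
  refine pow_ne_two_pow_of_odd hp ho (a := a) (b := c.den) (by omega) ?_
  exact_mod_cast h2

/-- The logarithms of distinct primes are not rationally proportional. -/
lemma injective_mul_log_prime {ι : Type*} (p : ι → ℕ) (hp : ∀ i, (p i).Prime)
    (hinj : Function.Injective p) (v : ι → ℤ) (hv : ∀ i, v i ≠ 0) :
    Function.Injective fun i => (v i : ℝ) * Real.log (p i : ℝ) := by
  intro i j hij
  simp only at hij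
  have hl : ∀ k, 0 < Real.log (p k) := fun k => Real.log_pos (by exact_mod_cast (hp k).one_lt)
  have h1 : ((v i).natAbs : ℝ) * Real.log (p i) = ((v j).natAbs : ℝ) * Real.log (p j) := by
    have := congrArg abs hij
    rw [abs_mul, abs_mul, abs_of_pos (hl i), abs_of_pos (hl j)] at this
    rw [Nat.cast_natAbs, Nat.cast_natAbs]
    exact_mod_cast this
  rw [← Real.log_pow, ← Real.log_pow] at h1
  have hpos : ∀ k, (0 : ℝ) < (p k : ℝ) ^ (v k).natAbs := fun k => by
    have := (hp k).pos; positivity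
  have h2 := Real.log_injOn_pos (Set.mem_Ioi.2 (hpos i)) (Set.mem_Ioi.2 (hpos j)) h1
  have h3 : p i ^ (v i).natAbs = p j ^ (v j).natAbs := by exact_mod_cast h2
  have h4 : p i ∣ p j ^ (v j).natAbs :=
    h3 ▸ dvd_pow_self (p i) (Int.natAbs_ne_zero.2 (hv i))
  exact hinj ((Nat.prime_dvd_prime_iff_eq (hp i) (hp j)).1 ((hp i).dvd_of_dvd_pow h4))

/-- A nontrivial Weyl sum at the points `∑ M i * α_i(n)` saves on average over `n` a power of its
length that does not depend on the frequency `M`. -/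
lemma exists_eventually_sum_weylMean_le {ι : Type*} [Fintype ι] [Nonempty ι] (p : ι → ℕ)
    (hp : ∀ i, (p i).Prime) (hodd : ∀ i, Odd (p i)) (hinj : Function.Injective p) :
    ∃ C : ℝ, 0 < C ∧ ∀ M : ι → ℤ, M ≠ 0 → ∀ q : ℝ, 1 ≤ q → ∀ S : ℕ,
      q ^ (4 * Fintype.card ι) ≤ S → ∀ ε : ℝ, 0 < ε → ∀ᶠ N : ℕ in atTop,
        ∑ n ∈ Finset.Icc 1 N, weylMean S (∑ i, M i * alphaSeq (p i) n) ≤ (C / q + ε) * N := by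
  set θ : ι → ℝ := fun i => Real.log 2 / Real.log (p i) with hθ
  have hp1 : ∀ i, (1 : ℝ) < p i := fun i => by exact_mod_cast (hp i).one_lt
  obtain ⟨v, hv, hvk⟩ := exists_direction θ fun i => irrational_log_two_div_log (hp i) (hodd i)
  obtain ⟨C, hC, hint⟩ := exists_integral_weylMean_le (fun i => (p i : ℝ)) hp1 v hv
    (injective_mul_log_prime p hp hinj v hv)
  refine ⟨C, hC, ?_⟩
  intro M hM q hq S hS ε hε
  set r := Fintype.card ι with hr
  have hrpos : (0 : ℝ) < r := by exact_mod_cast Fintype.card_pos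
  set η : ℝ := ε / (32 * r) with hη
  have hη0 : 0 < η := by positivity
  choose A hA using fun i => exists_continuous_eq_rpow_fract (p i : ℝ) (hp1 i) hη0
  set W : (ι → ℝ) → ℝ := fun X => weylMean S (∑ i, M i * (p i : ℝ) ^ (Int.fract (X i) - 1)) with hW
  set V : C(UnitAddTorus ι, ℝ) := ⟨fun x => weylMean S (∑ i, M i * A i (x i)),
    (continuous_weylMean S).comp (by fun_prop)⟩ with hV
  set U : C(UnitAddTorus ι, ℝ) := ⟨fun x => ∑ i, circleBump η (x i), by fun_prop⟩ with hU
  -- `W` and `V` differ only where the bumps add up to at least `1`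
  have hdiff : ∀ X : ι → ℝ, W X = V (torusPoint X) ∨ 1 ≤ U (torusPoint X) := by
    intro X
    by_cases hX : ∀ i, η ≤ ‖(X i : UnitAddCircle)‖
    · left
      simp only [hW, hV, ContinuousMap.coe_mk, torusPoint]
      congr 1
      exact Finset.sum_congr rfl fun i _ => by rw [hA i _ (hX i)]
    · right
      push Not at hX
      obtain ⟨i, hi⟩ := hX
      exact (one_le_circleBump hη0 hi.le).trans
        (Finset.single_le_sum (f := fun i => circleBump η (torusPoint X i))
          (fun i _ => circleBump_nonneg _ _) (Finset.mem_univ i))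
  have hU0 : ∀ x, 0 ≤ U x := fun x => Finset.sum_nonneg fun i _ => circleBump_nonneg _ _
  have hV0 : ∀ x, 0 ≤ V x := fun x => weylMean_nonneg _ _
  have hV1 : ∀ x, V x ≤ 1 := fun x => weylMean_le_one _ _
  have hWV : ∀ X, W X ≤ (V + U) (torusPoint X) := by
    intro X
    rw [ContinuousMap.add_apply]
    rcases hdiff X with h | h
    · linarith [hU0 (torusPoint X)]
    · linarith [hV0 (torusPoint X), weylMean_le_one S (∑ i, M i * (p i : ℝ) ^ (Int.fract (X i) - 1))]
  have hVW : ∀ X, V (torusPoint X) ≤ W X + U (torusPoint X) := by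
    intro X
    rcases hdiff X with h | h
    · linarith [hU0 (torusPoint X)]
    · linarith [hV1 (torusPoint X),
        weylMean_nonneg S (∑ i, M i * (p i : ℝ) ^ (Int.fract (X i) - 1))]
  have hflow : ∀ X : ι → ℝ,
      ∫ t in (0 : ℝ)..1, (V + U) (torusPoint fun i => X i + t * v i) ≤ C / q + ε / 2 := by
    intro X
    have hUint : ∫ t in (0 : ℝ)..1, U (torusPoint fun i => X i + t * v i) ≤ r * (8 * η) := by
      simp only [hU, ContinuousMap.coe_mk, torusPoint]
      rw [intervalIntegral.integral_finsetSum]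
      · calc _ ≤ ∑ _i : ι, 8 * η :=
            Finset.sum_le_sum fun i _ => integral_circleBump_flow_le hη0 (X i) (hv i)
          _ = _ := by rw [Finset.sum_const, Finset.card_univ, nsmul_eq_mul]
      · intro i _
        exact ((circleBump η).continuous.comp ((AddCircle.continuous_mk' 1).comp
          (by fun_prop : Continuous fun t : ℝ => X i + t * v i))).intervalIntegrable _ _
    have hUi : IntervalIntegrable (fun t : ℝ => U (torusPoint fun i => X i + t * v i)) volume 0 1 :=
      (U.continuous.comp (continuous_flow X v)).intervalIntegrable _ _
    have hWi : IntervalIntegrable (fun t : ℝ => W fun i => X i + t * v i) volume 0 1 := by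
      rw [intervalIntegrable_iff_integrableOn_Ioc_of_le zero_le_one]
      refine Measure.integrableOn_of_bounded (M := 1) (by simp) ?_ ?_
      · refine ((continuous_weylMean S).measurable.comp ?_).aestronglyMeasurable
        refine Finset.measurable_sum _ fun i _ => Measurable.const_mul ?_ _
        exact measurable_const.pow (by fun_prop)
      · refine Filter.Eventually.of_forall fun t => ?_
        rw [Real.norm_eq_abs, abs_of_nonneg (weylMean_nonneg _ _)]
        exact weylMean_le_one _ _
    calc ∫ t in (0 : ℝ)..1, (V + U) (torusPoint fun i => X i + t * v i)
        ≤ ∫ t in (0 : ℝ)..1, ((W fun i => X i + t * v i) +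
            2 * U (torusPoint fun i => X i + t * v i)) := by
          refine intervalIntegral.integral_mono_on zero_le_one
            (((V + U).continuous.comp (continuous_flow X v)).intervalIntegrable _ _)
            (hWi.add (hUi.const_mul 2)) fun t _ => ?_
          rw [ContinuousMap.add_apply]
          linarith [hVW fun i => X i + t * v i]
      _ = (∫ t in (0 : ℝ)..1, W fun i => X i + t * v i) +
            2 * ∫ t in (0 : ℝ)..1, U (torusPoint fun i => X i + t * v i) := by
          rw [intervalIntegral.integral_add hWi (hUi.const_mul 2),
            intervalIntegral.integral_const_mul]
      _ ≤ C / q + 2 * (r * (8 * η)) := by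
          have := hint M hM X q hq S hS
          linarith
      _ = C / q + ε / 2 := by
          rw [hη]; field_simp; ring
  filter_upwards [eventually_sum_le_of_flow_average_le θ v hvk (V + U) hflow (half_pos hε)]
    with N hN
  calc ∑ n ∈ Finset.Icc 1 N, weylMean S (∑ i, M i * alphaSeq (p i) n)
      = ∑ n ∈ Finset.Icc 1 N, W fun i => n * θ i := by
        refine Finset.sum_congr rfl fun n _ => ?_
        simp only [hW, hθ, alphaSeq, mul_div_assoc]
    _ ≤ ∑ n ∈ Finset.Icc 1 N, (V + U) (torusPoint fun i => n * θ i) :=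
        Finset.sum_le_sum fun n _ => hWV _
    _ ≤ (C / q + ε / 2 + ε / 2) * N := hN
    _ = (C / q + ε) * N := by ring

/-! ### Test functions with absolutely convergent Fourier series -/

/-- `F` is the sum of the trigonometric series with coefficients `c`, and the absolute values of the
coefficients add up to at most `1`. -/
structure HasFourierBall {ι : Type*} [Fintype ι] (F : (ι → ℝ) → ℂ) (c : (ι → ℤ) → ℂ) : Prop where
  summable : Summable fun M => ‖c M‖
  tsum_le : ∑' M, ‖c M‖ ≤ 1
  hasSum : ∀ x : ι → ℝ, HasSum
    (fun M => c M * Complex.exp (2 * Real.pi * Complex.I * (∑ i, M i * x i : ℝ))) (F x)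

/-- Terms of equal frequency in a trigonometric series may be collected. -/
lemma exists_hasFourierBall_of_hasSum {ι κ : Type*} [Fintype ι] {F : (ι → ℝ) → ℂ} (a : κ → ℂ)
    (φ : κ → ι → ℤ) (hs : Summable fun k => ‖a k‖) (h1 : ∑' k, ‖a k‖ ≤ 1)
    (hF : ∀ x : ι → ℝ, HasSum
      (fun k => a k * Complex.exp (2 * Real.pi * Complex.I * (∑ i, φ k i * x i : ℝ))) (F x)) :
    ∃ c, HasFourierBall F c := by
  have hn := hs.hasSum.tsum_fiberwise φ
  have hle : ∀ M, ‖∑' k : φ ⁻¹' {M}, a k‖ ≤ ∑' k : φ ⁻¹' {M}, ‖a k‖ := fun M =>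
    norm_tsum_le_tsum_norm (hs.subtype _)
  have hsum : Summable fun M => ‖∑' k : φ ⁻¹' {M}, a k‖ :=
    Summable.of_nonneg_of_le (fun _ => norm_nonneg _) hle hn.summable
  refine ⟨fun M => ∑' k : φ ⁻¹' {M}, a k, hsum, ?_, fun x => ?_⟩
  · refine (hsum.tsum_le_tsum hle hn.summable).trans ?_
    rw [hn.tsum_eq]; exact h1
  · refine ((hF x).tsum_fiberwise φ).congr_fun fun M => ?_
    rw [← tsum_mul_right]
    refine tsum_congr fun k => ?_
    have : φ k = M := k.2
    rw [this]

lemma exists_hasFourierBall_mul {ι : Type*} [Fintype ι] {F G : (ι → ℝ) → ℂ}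
    (hF : ∃ c, HasFourierBall F c) (hG : ∃ c, HasFourierBall G c) :
    ∃ c, HasFourierBall (fun x => F x * G x) c := by
  obtain ⟨c, hc⟩ := hF
  obtain ⟨d, hd⟩ := hG
  have hs : Summable fun k : (ι → ℤ) × (ι → ℤ) => ‖c k.1 * d k.2‖ :=
    (hc.summable.mul_of_nonneg hd.summable (fun _ => norm_nonneg _) fun _ => norm_nonneg _).congr
      fun k => (norm_mul _ _).symm
  refine exists_hasFourierBall_of_hasSum (fun k : (ι → ℤ) × (ι → ℤ) => c k.1 * d k.2)
    (fun k => k.1 + k.2) hs ?_ fun x => ?_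
  · have h := tsum_mul_tsum_of_summable_norm hc.summable.norm hd.summable.norm
    have h' : ∑' k : (ι → ℤ) × (ι → ℤ), ‖c k.1 * d k.2‖
        = (∑' M, ‖c M‖) * ∑' M, ‖d M‖ := by
      rw [h]; exact tsum_congr fun k => norm_mul _ _
    rw [h']
    exact mul_le_one₀ hc.tsum_le (tsum_nonneg fun _ => norm_nonneg _) hd.tsum_le
  · have hcn : ∀ (e : (ι → ℤ) → ℂ) (M : ι → ℤ), ‖e M *
        Complex.exp (2 * Real.pi * Complex.I * (∑ i, M i * x i : ℝ))‖ = ‖e M‖ := fun e M => by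
      rw [norm_mul, norm_exp_two_pi_I_mul, mul_one]
    have hcs : Summable fun M : ι → ℤ =>
        ‖c M * Complex.exp (2 * Real.pi * Complex.I * (∑ i, M i * x i : ℝ))‖ := by
      simpa only [hcn] using hc.summable
    have hds : Summable fun M : ι → ℤ =>
        ‖d M * Complex.exp (2 * Real.pi * Complex.I * (∑ i, M i * x i : ℝ))‖ := by
      simpa only [hcn] using hd.summable
    have haux : ∀ (f g : (ι → ℤ) → ℂ) (a b : ℂ), HasSum f a → HasSum g b →
        Summable (fun M => ‖f M‖) → Summable (fun M => ‖g M‖) →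
        HasSum (fun k : (ι → ℤ) × (ι → ℤ) => f k.1 * g k.2) (a * b) :=
      fun f g a b hf hg h1 h2 => hf.mul hg (summable_mul_of_summable_norm h1 h2)
    have hmul := haux _ _ _ _ (hc.hasSum x) (hd.hasSum x) hcs hds
    refine hmul.congr_fun fun k => ?_
    have : (2 * Real.pi * Complex.I * (∑ i, ((k.1 + k.2) i : ℤ) * x i : ℝ) : ℂ)
        = 2 * Real.pi * Complex.I * (∑ i, k.1 i * x i : ℝ)
          + 2 * Real.pi * Complex.I * (∑ i, k.2 i * x i : ℝ) := by
      rw [← mul_add, ← Complex.ofReal_add, ← Finset.sum_add_distrib]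
      congr 3
      ext i; simp [add_mul]
    rw [this, Complex.exp_add]; ring

lemma exists_hasFourierBall_prod {ι κ : Type*} [Fintype ι] (s : Finset κ)
    (F : κ → (ι → ℝ) → ℂ) (hF : ∀ k ∈ s, ∃ c, HasFourierBall (F k) c) :
    ∃ c, HasFourierBall (fun x => ∏ k ∈ s, F k x) c := by
  classical
  induction s using Finset.induction_on with
  | empty =>
    refine exists_hasFourierBall_of_hasSum (κ := Unit) (fun _ => 1) (fun _ => 0) ?_ ?_ fun x => ?_
    · exact Summable.of_finite
    · simp
    · simp
  | insert k s hk ih =>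
    simp only [Finset.prod_insert hk]
    exact exists_hasFourierBall_mul (hF k (Finset.mem_insert_self _ _))
      (ih fun j hj => hF j (Finset.mem_insert_of_mem hj))

/-- The constant term of an absolutely convergent trigonometric series is the mean of its sum. -/
lemma HasFourierBall.integral_eq {ι : Type*} [Fintype ι] {F : (ι → ℝ) → ℂ} {c : (ι → ℤ) → ℂ}
    (h : HasFourierBall F c) :
    ∫ x, F x ∂(Measure.pi fun _ : ι => volume.restrict (Set.Ioc (0 : ℝ) 1)) = c 0 := by
  classical
  set ν : Measure (ι → ℝ) := Measure.pi fun _ : ι => volume.restrict (Set.Ioc (0 : ℝ) 1) with hν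
  have : IsProbabilityMeasure (volume.restrict (Set.Ioc (0 : ℝ) 1)) := ⟨by simp⟩
  set G : (ι → ℤ) → (ι → ℝ) → ℂ := fun M x =>
    c M * Complex.exp (2 * Real.pi * Complex.I * (∑ i, M i * x i : ℝ)) with hG
  have hnorm : ∀ M x, ‖G M x‖ = ‖c M‖ := fun M x => by
    rw [hG, norm_mul, norm_exp_two_pi_I_mul, mul_one]
  have hcont : ∀ M, Continuous (G M) := fun M => by rw [hG]; fun_prop
  have hint : ∀ M, Integrable (G M) ν := fun M =>
    Integrable.of_bound (hcont M).aestronglyMeasurable ‖c M‖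
      (Filter.Eventually.of_forall fun x => (hnorm M x).le)
  have hsum := hasSum_integral_of_summable_integral_norm hint (by
    simp only [hnorm]
    simpa using h.summable)
  have hFG : ∀ x, ∑' M, G M x = F x := fun x => (h.hasSum x).tsum_eq
  simp only [hFG] at hsum
  have hterm : ∀ M, ∫ x, G M x ∂ν = if M = 0 then c 0 else 0 := by
    intro M
    have hprod : ∀ x : ι → ℝ, Complex.exp (2 * Real.pi * Complex.I * (∑ i, M i * x i : ℝ))
        = ∏ i, Complex.exp (2 * Real.pi * Complex.I * M i * x i) := by
      intro x
      rw [← Complex.exp_sum]; congr 1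
      push_cast
      rw [Finset.mul_sum]
      exact Finset.sum_congr rfl fun i _ => by ring
    simp only [hG, hprod]
    rw [integral_const_mul, hν, integral_fintype_prod_eq_prod
      (f := fun (i : ι) (y : ℝ) => Complex.exp (2 * Real.pi * Complex.I * M i * y))]
    split_ifs with hM
    · rw [hM]; simp
    · obtain ⟨i, hi⟩ : ∃ i, M i ≠ 0 := by
        by_contra hcon; push Not at hcon; exact hM (funext hcon)
      rw [Finset.prod_eq_zero (Finset.mem_univ i), mul_zero]
      rw [← intervalIntegral.integral_of_le zero_le_one]
      have hne : (2 * Real.pi * Complex.I * M i : ℂ) ≠ 0 :=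
        mul_ne_zero Complex.two_pi_I_ne_zero (Int.cast_ne_zero.2 hi)
      have h4 : Complex.exp (2 * Real.pi * Complex.I * M i) = 1 := by
        rw [mul_comm]; exact Complex.exp_int_mul_two_pi_mul_I (M i)
      rw [integral_exp_mul_complex hne]
      simp [h4]
  simp only [hterm] at hsum
  exact (hsum.unique (hasSum_ite_eq 0 (c 0)))

/-- The `1`-periodic tent of height `1` and half-width `a` centred at the integers. -/
noncomputable def tent (a y : ℝ) : ℝ := max 0 (1 - |y - round y| / a)

lemma tent_nonneg (a y : ℝ) : 0 ≤ tent a y := le_max_left _ _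

lemma tent_periodic (a : ℝ) : Function.Periodic (tent a) 1 := fun y => by
  simp only [tent]
  rw [show y + 1 = y + ((1 : ℤ) : ℝ) by simp, round_add_intCast]
  push_cast
  rw [show y + 1 - ((round y : ℝ) + 1) = y - round y by ring]

lemma continuous_tent (a : ℝ) : Continuous (tent a) := by
  have : tent a = fun y : ℝ => max 0 (1 - ‖(y : UnitAddCircle)‖ / a) := by
    ext y; rw [UnitAddCircle.norm_eq]; rfl
  rw [this]
  have h : Continuous fun y : ℝ => ‖(y : UnitAddCircle)‖ :=
    continuous_norm.comp (AddCircle.continuous_mk' (1 : ℝ))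
  fun_prop

/-- The Fourier coefficients of `tent a`. At `m = 0` the second summand is `0 / 0 = 0`. -/
noncomputable def tentCoeff (a : ℝ) (m : ℤ) : ℝ :=
  (if m = 0 then a else 0) + (1 - Real.cos (2 * Real.pi * (m * a))) / (2 * Real.pi ^ 2 * a * m ^ 2)

lemma tentCoeff_nonneg {a : ℝ} (ha : 0 < a) (m : ℤ) : 0 ≤ tentCoeff a m := by
  unfold tentCoeff
  have := Real.cos_le_one (2 * Real.pi * (m * a))
  refine add_nonneg (by split_ifs <;> linarith) (div_nonneg (by linarith) (by positivity))

/-- The second periodic Bernoulli polynomial near the origin, as a Fourier series. The term `m = 0`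
vanishes because `1 / 0 = 0`. -/
lemma hasSum_exp_div_sq {y : ℝ} (hy : |y| ≤ 1) :
    HasSum (fun m : ℤ => 1 / (m : ℂ) ^ 2 * Complex.exp (2 * Real.pi * Complex.I * (m * y : ℝ)))
      ((2 * Real.pi ^ 2 * (y ^ 2 - |y| + 1 / 6) : ℝ) : ℂ) := by
  have key : ∀ x ∈ Set.Icc (0 : ℝ) 1,
      HasSum (fun m : ℤ => 1 / (m : ℂ) ^ 2 * Complex.exp (2 * Real.pi * Complex.I * (m * x : ℝ)))
      ((2 * Real.pi ^ 2 * (x ^ 2 - x + 1 / 6) : ℝ) : ℂ) := by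
    intro x hx
    have hval : ((2 * Real.pi ^ 2 * (x ^ 2 - x + 1 / 6) : ℝ) : ℂ)
        = -(2 * Real.pi * Complex.I) ^ 2 / (Nat.factorial 2 : ℂ) * bernoulliFun 2 x := by
      rw [bernoulliFun_two, mul_pow, mul_pow, Complex.I_sq, Nat.factorial_two]
      push_cast; ring
    rw [hval]
    refine (hasSum_one_div_pow_mul_fourier_mul_bernoulliFun (le_refl 2) hx).congr_fun fun m => ?_
    rw [fourier_coe_apply]
    congr 2
    push_cast; ring
  rcases le_total 0 y with h0 | h0
  · rw [abs_of_nonneg h0] at hy ⊢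
    exact key y ⟨h0, hy⟩
  · rw [abs_of_nonpos h0] at hy ⊢
    rw [show y ^ 2 - -y + 1 / 6 = (1 + y) ^ 2 - (1 + y) + 1 / 6 by ring]
    refine (key (1 + y) ⟨by linarith, by linarith⟩).congr_fun fun m => ?_
    congr 1
    rw [← (Complex.exp_periodic.int_mul m) (2 * Real.pi * Complex.I * (m * y : ℝ))]
    congr 1
    push_cast; ring

lemma hasSum_tent {a : ℝ} (ha : 0 < a) (ha2 : a ≤ 1 / 2) (y : ℝ) :
    HasSum (fun m : ℤ => (tentCoeff a m : ℂ) *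
      Complex.exp (2 * Real.pi * Complex.I * (m * y : ℝ))) (tent a y : ℂ) := by
  set u : ℝ := y - round y with hu
  have hu2 : |u| ≤ 1 / 2 := abs_sub_round y
  have hexp : ∀ m : ℤ, Complex.exp (2 * Real.pi * Complex.I * (m * y : ℝ))
      = Complex.exp (2 * Real.pi * Complex.I * (m * u : ℝ)) := by
    intro m
    rw [← (Complex.exp_periodic.int_mul (m * round y)) (2 * Real.pi * Complex.I * (m * u : ℝ))]
    congr 1
    rw [hu]; push_cast; ring
  have hu' := abs_le.1 hu2
  have h0 := hasSum_exp_div_sq (y := u) (by linarith)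
  have h1 := hasSum_exp_div_sq (y := u + a) (abs_le.2 ⟨by linarith, by linarith⟩)
  have h2 := hasSum_exp_div_sq (y := u - a) (abs_le.2 ⟨by linarith, by linarith⟩)
  -- a second difference of the periodic Bernoulli polynomial is a tent minus its mean
  have h3 := (((h0.mul_left 2).sub (h1.add h2)).mul_left (1 / (4 * Real.pi ^ 2 * a : ℂ))).add
    (hasSum_ite_eq (0 : ℤ) (a : ℂ))
  have hpi : (Real.pi : ℂ) ≠ 0 := Complex.ofReal_ne_zero.2 Real.pi_ne_zero
  have haC : (a : ℂ) ≠ 0 := Complex.ofReal_ne_zero.2 ha.ne'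
  have hreal : tent a y = 1 / (4 * Real.pi ^ 2 * a) * (2 * (2 * Real.pi ^ 2 * (u ^ 2 - |u| + 1 / 6))
      - (2 * Real.pi ^ 2 * ((u + a) ^ 2 - |u + a| + 1 / 6)
        + 2 * Real.pi ^ 2 * ((u - a) ^ 2 - |u - a| + 1 / 6))) + a := by
    have h4 : tent a y = (-|u| * 2 + |u + a| + |u - a|) / (2 * a) := by
      rw [tent, ← hu]
      have h5 : |u + a| + |u - a| = 2 * max |u| a := by
        rcases le_total 0 u with h | h
        · rw [abs_of_nonneg h, abs_of_nonneg (by linarith : 0 ≤ u + a)]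
          rcases le_total a u with h' | h'
          · rw [abs_of_nonneg (by linarith), max_eq_left h']; ring
          · rw [abs_of_nonpos (by linarith), max_eq_right h']; ring
        · rw [abs_of_nonpos h, abs_of_nonpos (by linarith : u - a ≤ 0)]
          rcases le_total a (-u) with h' | h'
          · rw [abs_of_nonpos (by linarith), max_eq_left h']; ring
          · rw [abs_of_nonneg (by linarith), max_eq_right h']; ring
      rw [show -|u| * 2 + |u + a| + |u - a| = 2 * (max |u| a - |u|) by linarith]
      rcases le_total a |u| with h' | h'
      · rw [max_eq_left h', sub_self, max_eq_left]
        · simp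
        · rw [sub_nonpos, one_le_div ha]; exact h'
      · rw [max_eq_right h', max_eq_right]
        · field_simp
        · rw [sub_nonneg, div_le_one ha]; exact h'
    rw [h4]
    have := Real.pi_ne_zero
    field_simp
    ring
  have hval : (tent a y : ℂ) = 1 / (4 * Real.pi ^ 2 * a) *
      (2 * ((2 * Real.pi ^ 2 * (u ^ 2 - |u| + 1 / 6) : ℝ) : ℂ) -
        (((2 * Real.pi ^ 2 * ((u + a) ^ 2 - |u + a| + 1 / 6) : ℝ) : ℂ) +
          ((2 * Real.pi ^ 2 * ((u - a) ^ 2 - |u - a| + 1 / 6) : ℝ) : ℂ))) + a := by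
    rw [hreal]; push_cast; ring
  rw [hval]
  refine h3.congr_fun fun m => ?_
  rw [hexp m]
  have e1 : Complex.exp (2 * Real.pi * Complex.I * (m * (u + a) : ℝ))
      = Complex.exp (2 * Real.pi * Complex.I * (m * u : ℝ)) *
        Complex.exp ((2 * Real.pi * (m * a) : ℝ) * Complex.I) := by
    rw [← Complex.exp_add]; congr 1; push_cast; ring
  have e2 : Complex.exp (2 * Real.pi * Complex.I * (m * (u - a) : ℝ))
      = Complex.exp (2 * Real.pi * Complex.I * (m * u : ℝ)) *
        Complex.exp (-((2 * Real.pi * (m * a) : ℝ) : ℂ) * Complex.I) := by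
    rw [← Complex.exp_add]; congr 1; push_cast; ring
  have e3 : (Real.cos (2 * Real.pi * (m * a)) : ℂ)
      = (Complex.exp ((2 * Real.pi * (m * a) : ℝ) * Complex.I) +
        Complex.exp (-((2 * Real.pi * (m * a) : ℝ) : ℂ) * Complex.I)) / 2 := by
    rw [Complex.ofReal_cos]; rfl
  rw [e1, e2, tentCoeff, Complex.ofReal_add, Complex.ofReal_div, Complex.ofReal_sub, e3]
  by_cases hm : m = 0
  · subst hm; simp
  · have hmC : (m : ℂ) ≠ 0 := Int.cast_ne_zero.2 hm
    simp only [hm, if_false]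
    push_cast
    field_simp
    ring


lemma hasSum_tentCoeff {a : ℝ} (ha : 0 < a) (ha2 : a ≤ 1 / 2) : HasSum (tentCoeff a) 1 := by
  have h := hasSum_tent ha ha2 0
  simp only [tent, mul_zero, Complex.ofReal_zero, Complex.exp_zero, mul_one] at h
  have h2 : HasSum (fun m => (tentCoeff a m : ℂ)) ((1 : ℝ) : ℂ) := by simpa using h
  exact_mod_cast h2

lemma exists_hasFourierBall_tent {ι : Type*} [Fintype ι] {a : ℝ} (ha : 0 < a) (ha2 : a ≤ 1 / 2)
    (i : ι) (l : ℤ) (z : ℝ) :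
    ∃ c, HasFourierBall (fun x : ι → ℝ => (tent a (l * x i - z) : ℂ)) c := by
  classical
  have hn : ∀ m : ℤ, ‖(tentCoeff a m : ℂ) * Complex.exp (2 * Real.pi * Complex.I * (-(m * z) : ℝ))‖
      = tentCoeff a m := by
    intro m
    rw [norm_mul, norm_exp_two_pi_I_mul, mul_one, Complex.norm_real, Real.norm_eq_abs,
      abs_of_nonneg (tentCoeff_nonneg ha m)]
  have hs := hasSum_tentCoeff ha ha2
  refine exists_hasFourierBall_of_hasSum
    (fun m : ℤ => (tentCoeff a m : ℂ) * Complex.exp (2 * Real.pi * Complex.I * (-(m * z) : ℝ)))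
    (fun m => Pi.single i (m * l)) ?_ ?_ fun x => ?_
  · simp only [hn]; exact hs.summable
  · simp only [hn]; exact hs.tsum_eq.le
  · refine (hasSum_tent ha ha2 (l * x i - z)).congr_fun fun m => ?_
    rw [mul_assoc, ← Complex.exp_add]
    congr 2
    rw [Finset.sum_eq_single i (by intro j _ hj; simp [Pi.single_eq_of_ne hj]) (by simp)]
    rw [Pi.single_eq_same]
    push_cast; ring

/-! ### Test functions for digit restrictions -/

lemma fract_lt_of_tent_ne_zero {a u : ℝ} (ha : 0 < a) (ha2 : a ≤ 1 / 2)
    (h : tent a (u - a) ≠ 0) : Int.fract u < 2 * a := by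
  have h1 : |u - a - round (u - a)| < a := by
    by_contra hcon
    apply h
    apply max_eq_left
    rw [sub_nonpos, one_le_div ha]
    exact not_lt.1 hcon
  have h2 := abs_lt.1 h1
  have hfl : ⌊u⌋ = round (u - a) := by
    rw [Int.floor_eq_iff]
    constructor <;> linarith
  rw [← Int.self_sub_floor, hfl]
  linarith

lemma fract_mem_smallDigitSet_of_lt {p H : ℕ} {y : ℝ} (h : Int.fract y < 1 / (p : ℝ) ^ H) :
    Int.fract y ∈ smallDigitSet p H :=
  Set.mem_add.2 ⟨0, ⟨fun _ => 0, fun _ => by simp; positivity, by simp⟩, Int.fract y,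
    ⟨Int.fract_nonneg y, h⟩, zero_add _⟩

/-- The base `p` digits of `{y}` are read off from the fractional parts of `p ^ k * y`. -/
lemma fract_mem_smallDigitSet_of_forall_lt {p H : ℕ} (hp : 0 < p) {y : ℝ}
    (h : ∀ k < H, Int.fract ((p : ℝ) ^ k * y) < 1 / 3) : Int.fract y ∈ smallDigitSet p H := by
  have hpR : (0 : ℝ) < p := by exact_mod_cast hp
  set x : ℕ → ℝ := fun k => Int.fract ((p : ℝ) ^ k * y) with hx
  have hx0 : ∀ k, 0 ≤ x k := fun k => Int.fract_nonneg _
  set d : ℕ → ℕ := fun k => ⌊p * x k⌋₊ with hd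
  have hstep : ∀ k, x (k + 1) = p * x k - d k := by
    intro k
    have h1 : ((d k : ℕ) : ℝ) = (⌊p * x k⌋ : ℤ) := natCast_floor_eq_intCast_floor (by
      have := hx0 k; positivity)
    have h2 : (p : ℝ) ^ (k + 1) * y = p * x k + ((p * ⌊(p : ℝ) ^ k * y⌋ : ℤ) : ℝ) := by
      simp only [hx]
      rw [← Int.self_sub_floor]
      push_cast; ring
    have h3 : x (k + 1) = Int.fract (p * x k) := by
      simp only [hx] at h2 ⊢
      rw [h2, Int.fract_add_intCast]
    rw [h3, h1, Int.self_sub_floor]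
  refine Set.mem_add.2 ⟨_, ⟨fun k => d k, fun k => ?_, rfl⟩, x H / (p : ℝ) ^ H, ⟨?_, ?_⟩, ?_⟩
  · have h1 : (d k : ℝ) ≤ p * x k := Nat.floor_le (by have := hx0 k; positivity)
    have h2 := h k k.2
    simp only [hx] at h1
    nlinarith
  · have := hx0 H; positivity
  · gcongr
    exact Int.fract_lt_one _
  · rw [Fin.sum_univ_eq_sum_range (fun k => (d k : ℝ) / (p : ℝ) ^ (k + 1)) H]
    have h1 : ∀ k ∈ Finset.range H, (d k : ℝ) / (p : ℝ) ^ (k + 1)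
        = x k / (p : ℝ) ^ k - x (k + 1) / (p : ℝ) ^ (k + 1) := by
      intro k _
      rw [hstep k]
      field_simp
      ring
    rw [Finset.sum_congr rfl h1, Finset.sum_range_sub']
    simp [hx]

/-- The product of tents of half-width `a` that test the position of `{p ^ k * y}` in `[0, 2 a]` for
`k < L`. -/
noncomputable def digitBump (p L : ℕ) (a y : ℝ) : ℝ :=
  ∏ k ∈ Finset.range L, tent a ((p : ℝ) ^ k * y - a)

lemma digitBump_nonneg (p L : ℕ) (a y : ℝ) : 0 ≤ digitBump p L a y :=
  Finset.prod_nonneg fun _ _ => tent_nonneg _ _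

lemma continuous_digitBump (p L : ℕ) (a : ℝ) : Continuous (digitBump p L a) :=
  continuous_finsetProd _ fun _ _ => (continuous_tent a).comp (by fun_prop)

lemma digitBump_periodic (p L : ℕ) (a : ℝ) : Function.Periodic (digitBump p L a) 1 := by
  intro y
  refine Finset.prod_congr rfl fun k _ => ?_
  have h := (tent_periodic a).nat_mul (p ^ k) ((p : ℝ) ^ k * y - a)
  rw [← h]
  congr 1
  push_cast; ring

lemma digitBump_succ (p L : ℕ) (a y : ℝ) :
    digitBump p (L + 1) a y = tent a (y - a) * digitBump p L a (p * y) := by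
  unfold digitBump
  rw [Finset.prod_range_succ', mul_comm]
  congr 1
  · simp
  · exact Finset.prod_congr rfl fun k _ => by rw [pow_succ, mul_assoc]

lemma half_le_tent {a u : ℝ} (ha : 0 < a) (h : |u| ≤ a / 2) : 1 / 2 ≤ tent a u := by
  refine le_trans ?_ (le_max_right _ _)
  have h1 : |u - round u| ≤ |u| := by simpa using round_le u 0
  have h2 : |u - round u| / a ≤ 1 / 2 := by rw [div_le_iff₀ ha]; linarith
  linarith

/-- Restricting to an interval of `[0, 1]` on which the first tent is at least `1 / 2`, and which
consists of `m` full periods of the remaining factors. -/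
lemma integral_digitBump_succ_ge {p L : ℕ} (hp : 0 < p) {a : ℝ} (ha : 0 < a) (ha2 : a ≤ 1 / 2)
    {l m : ℕ} (hl : a / 2 ≤ (l : ℝ) / p) (hm : ((l + m : ℕ) : ℝ) / p ≤ 3 * a / 2) :
    (m : ℝ) / (2 * p) * ∫ y in (0 : ℝ)..1, digitBump p L a y
      ≤ ∫ y in (0 : ℝ)..1, digitBump p (L + 1) a y := by
  have hpR : (0 : ℝ) < p := by exact_mod_cast hp
  have hlm : (l : ℝ) / p ≤ ((l + m : ℕ) : ℝ) / p := by
    push_cast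
    gcongr
    linarith [(Nat.cast_nonneg m : (0 : ℝ) ≤ m)]
  have hper : ∫ y in (l : ℝ) / p..((l + m : ℕ) : ℝ) / p, digitBump p L a (p * y)
      = m / p * ∫ y in (0 : ℝ)..1, digitBump p L a y := by
    rw [intervalIntegral.integral_comp_mul_left _ hpR.ne', mul_div_cancel₀ _ hpR.ne',
      mul_div_cancel₀ _ hpR.ne']
    have h := (digitBump_periodic p L a).intervalIntegral_add_zsmul_eq (m : ℤ) (l : ℝ)
      (fun _ _ => (continuous_digitBump p L a).intervalIntegrable _ _)
    rw [show ((l + m : ℕ) : ℝ) = (l : ℝ) + (m : ℤ) • (1 : ℝ) by push_cast; simp, h,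
      (digitBump_periodic p L a).intervalIntegral_add_eq (l : ℝ) 0, zero_add, zsmul_eq_mul,
      smul_eq_mul, Int.cast_natCast]
    ring
  have hc1 : Continuous fun y : ℝ => digitBump p L a (p * y) :=
    (continuous_digitBump p L a).comp (by fun_prop)
  calc (m : ℝ) / (2 * p) * ∫ y in (0 : ℝ)..1, digitBump p L a y
      = ∫ y in (l : ℝ) / p..((l + m : ℕ) : ℝ) / p, 1 / 2 * digitBump p L a (p * y) := by
        rw [intervalIntegral.integral_const_mul, hper]
        ring
    _ ≤ ∫ y in (l : ℝ) / p..((l + m : ℕ) : ℝ) / p, digitBump p (L + 1) a y := by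
        refine intervalIntegral.integral_mono_on hlm
          ((continuous_const.mul hc1).intervalIntegrable _ _)
          ((continuous_digitBump p _ a).intervalIntegrable _ _) fun y hy => ?_
        rw [digitBump_succ]
        refine mul_le_mul_of_nonneg_right (half_le_tent ha (abs_le.2 ⟨?_, ?_⟩))
          (digitBump_nonneg _ _ _ _)
        · linarith [hy.1]
        · linarith [hy.2]
    _ ≤ ∫ y in (0 : ℝ)..1, digitBump p (L + 1) a y := by
        refine intervalIntegral.integral_mono_interval (by positivity) hlm (by linarith)
          (Filter.Eventually.of_forall fun y => digitBump_nonneg _ _ _ _)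
          ((continuous_digitBump p _ a).intervalIntegrable _ _)

/-- A product of tents supported, modulo `1`, on the numbers with small digits, whose mean decays at
a rate independent of `p`. For large `p` each digit is tested by its own tent; for bounded `p` a
single tent tests whether the first `H` digits vanish. -/
lemma exists_digitBump {p : ℕ} (hp : 2 ≤ p) (H : ℕ) :
    ∃ (L : ℕ) (a : ℝ), 0 < a ∧ a ≤ 1 / 2 ∧
      (∀ y, digitBump p L a y ≠ 0 → Int.fract y ∈ smallDigitSet p H) ∧
      1 / (4 * 50 ^ H) ≤ ∫ y in (0 : ℝ)..1, digitBump p L a y := by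
  have hp0 : 0 < p := by omega
  have hpR : (2 : ℝ) ≤ p := by exact_mod_cast hp
  by_cases h50 : p ≤ 50
  · have h1 : (1 : ℝ) ≤ (p : ℝ) ^ H := one_le_pow₀ (by linarith)
    set a : ℝ := 1 / (2 * (p : ℝ) ^ H) with ha
    have ha0 : 0 < a := by positivity
    have ha2 : a ≤ 1 / 2 := by
      rw [ha]
      exact one_div_le_one_div_of_le (by norm_num) (by linarith)
    refine ⟨1, a, ha0, ha2, fun y hy => ?_, ?_⟩
    · apply fract_mem_smallDigitSet_of_lt
      have hne : tent a (y - a) ≠ 0 := by simpa [digitBump] using hy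
      refine (fract_lt_of_tent_ne_zero ha0 ha2 hne).trans_le (le_of_eq ?_)
      rw [ha]; field_simp
    · have hb : ∀ y, digitBump p 1 a y = tent a (y - a) := fun y => by simp [digitBump]
      simp only [hb]
      have hc : Continuous fun y => tent a (y - a) := (continuous_tent a).comp (by fun_prop)
      calc (1 : ℝ) / (4 * 50 ^ H) ≤ a / 2 := by
            rw [ha, div_div]
            apply one_div_le_one_div_of_le (by positivity)
            have : (p : ℝ) ^ H ≤ 50 ^ H := by
              gcongr; exact_mod_cast h50
            linarith
        _ = ∫ _y in (a / 2)..(3 * a / 2), (1 / 2 : ℝ) := by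
            rw [intervalIntegral.integral_const, smul_eq_mul]; ring
        _ ≤ ∫ y in (a / 2)..(3 * a / 2), tent a (y - a) := by
            refine intervalIntegral.integral_mono_on (by linarith)
              (continuous_const.intervalIntegrable _ _) (hc.intervalIntegrable _ _) fun y hy => ?_
            exact half_le_tent ha0 (abs_le.2 ⟨by linarith [hy.1], by linarith [hy.2]⟩)
        _ ≤ ∫ y in (0 : ℝ)..1, tent a (y - a) :=
            intervalIntegral.integral_mono_interval (by linarith) (by linarith) (by linarith)
              (Filter.Eventually.of_forall fun y => tent_nonneg _ _) (hc.intervalIntegrable _ _)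
  · push Not at h50
    have h50R : (50 : ℝ) < p := by exact_mod_cast h50
    refine ⟨H, 1 / 6, by norm_num, by norm_num, fun y hy => ?_, ?_⟩
    · refine fract_mem_smallDigitSet_of_forall_lt hp0 fun k hk => ?_
      have := fract_lt_of_tent_ne_zero (by norm_num) (by norm_num)
        (Finset.prod_ne_zero_iff.1 hy k (Finset.mem_range.2 hk))
      linarith
    · -- the digits between `p / 12` and `p / 4` form a proportion of at least `1 / 25`
      set l : ℕ := ⌈(p : ℝ) / 12⌉₊ with hl
      have hl1 : (p : ℝ) / 12 ≤ l := Nat.le_ceil _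
      have hl2 : (l : ℝ) ≤ p / 12 + 1 := (Nat.ceil_lt_add_one (by positivity)).le
      set m : ℕ := ⌊(p : ℝ) / 4 - l⌋₊ with hm
      have hm1 : (m : ℝ) ≤ p / 4 - l := Nat.floor_le (by linarith)
      have hm2 : (p : ℝ) / 4 - l < m + 1 := Nat.lt_floor_add_one _
      have hpp : (0 : ℝ) < p := by linarith
      have hstep : ∀ L, 1 / 50 * ∫ y in (0 : ℝ)..1, digitBump p L (1 / 6) y
          ≤ ∫ y in (0 : ℝ)..1, digitBump p (L + 1) (1 / 6) y := by
        intro L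
        refine le_trans ?_ (integral_digitBump_succ_ge hp0 (by norm_num) (by norm_num)
          (l := l) (m := m) ?_ ?_)
        · refine mul_le_mul_of_nonneg_right ?_
            (intervalIntegral.integral_nonneg zero_le_one fun y _ => digitBump_nonneg _ _ _ _)
          rw [div_le_div_iff₀ (by norm_num) (by positivity)]
          linarith
        · rw [le_div_iff₀ hpp]; linarith
        · rw [div_le_iff₀ hpp]; push_cast; linarith
      have hind : ∀ L, (1 : ℝ) / 50 ^ L ≤ ∫ y in (0 : ℝ)..1, digitBump p L (1 / 6) y := by
        intro L
        induction L with
        | zero => simp [digitBump]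
        | succ L ih =>
          refine le_trans ?_ (hstep L)
          rw [pow_succ, ← div_div, mul_comm (1 / 50 : ℝ), mul_one_div]
          gcongr
      refine le_trans ?_ (hind H)
      apply one_div_le_one_div_of_le (by positivity)
      have : (0 : ℝ) < 50 ^ H := by positivity
      linarith

/-- A test function for the simultaneous digit restrictions, with constant Fourier coefficient
bounded below. -/
lemma exists_hasFourierBall_smallDigitSet {ι : Type*} [Fintype ι] (p : ι → ℕ)
    (hp : ∀ i, 2 ≤ p i) (H : ℕ) :
    ∃ (F : (ι → ℝ) → ℂ) (c : (ι → ℤ) → ℂ), HasFourierBall F c ∧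
      (∀ x, F x ≠ 0 → ∀ i, Int.fract (x i) ∈ smallDigitSet (p i) H) ∧
      (1 / (4 * 50 ^ H) : ℝ) ^ Fintype.card ι ≤ ‖c 0‖ := by
  choose L a ha ha2 hsupp hmean using fun i => exists_digitBump (hp i) H
  obtain ⟨c, hc⟩ := exists_hasFourierBall_prod Finset.univ
    (fun i (x : ι → ℝ) => ((digitBump (p i) (L i) (a i) (x i) : ℝ) : ℂ)) (fun i _ => by
      have h := exists_hasFourierBall_prod (Finset.range (L i))
        (fun k (x : ι → ℝ) => (tent (a i) (((p i ^ k : ℕ) : ℤ) * x i - a i) : ℂ))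
        (fun k _ => exists_hasFourierBall_tent (ha i) (ha2 i) i _ _)
      simpa [digitBump] using h)
  refine ⟨_, c, hc, fun x hx i => hsupp i _ fun h0 => hx ?_, ?_⟩
  · exact Finset.prod_eq_zero (Finset.mem_univ i) (by rw [h0]; simp)
  · rw [← hc.integral_eq, integral_fintype_prod_eq_prod
      (f := fun (i : ι) (y : ℝ) => ((digitBump (p i) (L i) (a i) y : ℝ) : ℂ)), norm_prod,
      ← Finset.card_univ, ← Finset.prod_const]
    refine Finset.prod_le_prod (fun _ _ => by positivity) fun i _ => ?_
    rw [integral_complex_ofReal, Complex.norm_real, Real.norm_eq_abs,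
      ← intervalIntegral.integral_of_le zero_le_one]
    exact (hmean i).trans (le_abs_self _)

/-! ### Density of the exceptional integers -/

/-- The integers `n` for which some shift `b` defeats every `s`. -/
def exceptionalSet {r : ℕ} (p : Fin r → ℕ) (H : ℕ) : Set ℕ :=
  {n : ℕ | ∃ b : Fin r → ℝ, ∀ s : ℕ, 1 ≤ s → s ≤ 10 ^ (10 * r ^ 2 * H) →
    ¬ ∀ j : Fin r, Int.fract ((s : ℝ) * alphaSeq (p j) n + b j) ∈ smallDigitSet (p j) H}

/-- If a test function vanishes at all the points `s * α + b` with `1 ≤ s ≤ S`, its constant term is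
dominated by the Weyl sums at the other frequencies, which do not depend on `b`. -/
lemma HasFourierBall.norm_zero_le {ι : Type*} [Fintype ι] [DecidableEq ι] {F : (ι → ℝ) → ℂ}
    {c : (ι → ℤ) → ℂ} (h : HasFourierBall F c) {S : ℕ} (hS : 0 < S) (α b : ι → ℝ)
    (hF : ∀ s ∈ Finset.Icc 1 S, F (fun i => s * α i + b i) = 0) :
    ‖c 0‖ ≤ ∑' M : ι → ℤ, if M = 0 then 0 else ‖c M‖ * weylMean S (∑ i, M i * α i) := by
  have hSR : (0 : ℝ) < S := by exact_mod_cast hS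
  set T : (ι → ℤ) → ℂ := fun M => ∑ s ∈ Finset.Icc 1 S,
    c M * Complex.exp (2 * Real.pi * Complex.I * (∑ i, M i * (s * α i + b i) : ℝ)) with hT
  have hsum : HasSum T 0 := by
    have := hasSum_sum fun (s : ℕ) (_ : s ∈ Finset.Icc 1 S) => h.hasSum fun i => s * α i + b i
    rwa [Finset.sum_eq_zero hF] at this
  have hnorm : ∀ M, ‖T M‖ = S * (‖c M‖ * weylMean S (∑ i, M i * α i)) := by
    intro M
    have h1 : T M = c M * Complex.exp (2 * Real.pi * Complex.I * (∑ i, M i * b i : ℝ)) *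
        ∑ s ∈ Finset.Icc 1 S, Complex.exp (2 * Real.pi * Complex.I * (s * ∑ i, M i * α i : ℝ)) := by
      simp only [hT]
      rw [Finset.mul_sum]
      refine Finset.sum_congr rfl fun s _ => ?_
      rw [mul_assoc (c M), ← Complex.exp_add, ← mul_add, ← Complex.ofReal_add, Finset.mul_sum,
        ← Finset.sum_add_distrib]
      congr 4
      exact Finset.sum_congr rfl fun i _ => by ring
    rw [h1, norm_mul, norm_mul, norm_exp_two_pi_I_mul, mul_one, weylMean, mul_left_comm,
      mul_div_cancel₀ _ hSR.ne']
  have hzero : T 0 = S * c 0 := by simp [hT]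
  have hrest : HasSum (fun M => T M - if M = 0 then T 0 else 0) (0 - T 0) :=
    hsum.sub (hasSum_ite_eq 0 (T 0))
  have hite : ∀ M, ‖T M - if M = 0 then T 0 else 0‖
      = S * (if M = 0 then 0 else ‖c M‖ * weylMean S (∑ i, M i * α i)) := by
    intro M
    split_ifs with hM
    · subst hM; simp
    · rw [sub_zero, hnorm]
  have hsn : Summable fun M => ‖T M - if M = 0 then T 0 else 0‖ := by
    refine Summable.of_nonneg_of_le (fun _ => norm_nonneg _) (fun M => ?_)
      (h.summable.mul_left (S : ℝ))
    rw [hite]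
    refine mul_le_mul_of_nonneg_left ?_ hSR.le
    split_ifs
    · exact norm_nonneg _
    · exact mul_le_of_le_one_right (norm_nonneg _) (weylMean_le_one _ _)
  have hle := norm_tsum_le_tsum_norm hsn
  rw [hrest.tsum_eq, zero_sub, norm_neg, tsum_congr hite, tsum_mul_left, hzero, norm_mul,
    Complex.norm_natCast] at hle
  exact le_of_mul_le_mul_left hle hSR

open Classical in
/-- The exceptional integers have upper density tending to zero as the number of digits grows. -/
lemma exists_eventually_card_exceptionalSet_le {r : ℕ} (p : Fin r → ℕ) (hp : ∀ i, (p i).Prime)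
    (hodd : ∀ i, Odd (p i)) (hinj : Function.Injective p) :
    ∃ δ : ℕ → ℝ, Tendsto δ atTop (𝓝 0) ∧ ∀ H : ℕ, ∀ᶠ N : ℕ in atTop,
      (((Finset.Icc 1 N).filter (· ∈ exceptionalSet p H)).card : ℝ) ≤ δ H * N := by
  rcases Nat.eq_zero_or_pos r with rfl | hr
  · refine ⟨fun _ => 0, tendsto_const_nhds, fun H => Filter.Eventually.of_forall fun N => ?_⟩
    rw [Finset.card_eq_zero.2]
    · simp
    · refine Finset.filter_eq_empty_iff.2 fun n _ hn => ?_
      obtain ⟨b, hb⟩ := hn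
      exact hb 1 le_rfl (by simp) fun j => j.elim0
  have : Nonempty (Fin r) := ⟨⟨0, hr⟩⟩
  obtain ⟨C, hC, hweyl⟩ := exists_eventually_sum_weylMean_le p hp hodd hinj
  rw [Fintype.card_fin] at hweyl
  refine ⟨fun H => (4 ^ r * C + 1) * (1 / 2) ^ H, ?_, fun H => ?_⟩
  · simpa using (tendsto_pow_atTop_nhds_zero_of_lt_one (by norm_num : (0 : ℝ) ≤ 1 / 2)
      (by norm_num)).const_mul (4 ^ r * C + 1)
  obtain ⟨F, c, hc, hsupp, hc0⟩ := exists_hasFourierBall_smallDigitSet p (fun i => (hp i).two_le) H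
  rw [Fintype.card_fin] at hc0
  set S : ℕ := 10 ^ (10 * r ^ 2 * H) with hS
  have hSpos : 0 < S := by positivity
  set q : ℝ := 100 ^ (r * H) with hq
  have hq1 : 1 ≤ q := one_le_pow₀ (by norm_num)
  have hqS : q ^ (4 * r) ≤ S := by
    rw [hq, hS, ← pow_mul, show (100 : ℝ) = 10 ^ 2 by norm_num, ← pow_mul]
    push_cast
    refine pow_le_pow_right₀ (by norm_num) ?_
    nlinarith [Nat.zero_le (r ^ 2 * H)]
  set μ : ℝ := (1 / (4 * 50 ^ H)) ^ r with hμ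
  have hμ0 : 0 < μ := by positivity
  -- an error negligible against the lower bound `μ` for the constant Fourier coefficient
  set ε : ℝ := μ * (1 / 2) ^ H / 2 with hε
  have hε0 : 0 < ε := by positivity
  -- all but finitely many frequencies carry total weight at most `ε`
  obtain ⟨T, hT⟩ := (hc.summable.hasSum.eventually
    (lt_mem_nhds (sub_lt_self (∑' M, ‖c M‖) hε0))).exists
  have hev : ∀ᶠ N : ℕ in atTop, ∀ M ∈ T, M ≠ 0 →
      ∑ n ∈ Finset.Icc 1 N, weylMean S (∑ i, M i * alphaSeq (p i) n) ≤ (C / q + ε) * N := by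
    refine (Filter.eventually_all_finset T).2 fun M _ => ?_
    by_cases hM : M = 0
    · exact Filter.Eventually.of_forall fun N h => absurd hM h
    · filter_upwards [hweyl M hM q hq1 S hqS ε hε0] with N hN _ using hN
  filter_upwards [hev] with N hN
  set D : ℕ → (Fin r → ℤ) → ℝ := fun n M =>
    if M = 0 then 0 else ‖c M‖ * weylMean S (∑ i, M i * alphaSeq (p i) n) with hD
  have hD0 : ∀ n M, 0 ≤ D n M := fun n M => by
    simp only [hD]
    split_ifs
    · exact le_rfl
    · exact mul_nonneg (norm_nonneg _) (weylMean_nonneg _ _)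
  have hDle : ∀ n M, D n M ≤ ‖c M‖ := fun n M => by
    simp only [hD]
    split_ifs
    · exact norm_nonneg _
    · exact mul_le_of_le_one_right (norm_nonneg _) (weylMean_le_one _ _)
  have hDs : ∀ n, Summable (D n) := fun n =>
    Summable.of_nonneg_of_le (hD0 n) (hDle n) hc.summable
  have htail : ∀ n, ∑' M, D n M ≤ (∑ M ∈ T, D n M) + ε := by
    intro n
    have h1 := (hc.summable.sub (hDs n)).sum_le_tsum T
      (fun M _ => sub_nonneg.2 (hDle n M))
    rw [hc.summable.tsum_sub (hDs n), Finset.sum_sub_distrib] at h1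
    linarith
  have hexc : ∀ n ∈ exceptionalSet p H, μ ≤ ∑' M, D n M := by
    rintro n ⟨b, hb⟩
    refine hc0.trans (hc.norm_zero_le hSpos (fun i => alphaSeq (p i) n) b fun s hs => ?_)
    by_contra hne
    obtain ⟨hs1, hs2⟩ := Finset.mem_Icc.1 hs
    exact hb s hs1 hs2 (hsupp _ hne)
  have hTsum : ∑ M ∈ T, ‖c M‖ ≤ 1 :=
    (hc.summable.sum_le_tsum T fun _ _ => norm_nonneg _).trans hc.tsum_le
  have hCq : 0 ≤ C / q + ε := by positivity
  have hcount : μ * ((Finset.Icc 1 N).filter (· ∈ exceptionalSet p H)).card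
      ≤ (C / q + 2 * ε) * N := by
    calc μ * ((Finset.Icc 1 N).filter (· ∈ exceptionalSet p H)).card
        = ∑ _n ∈ (Finset.Icc 1 N).filter (· ∈ exceptionalSet p H), μ := by
          rw [Finset.sum_const, nsmul_eq_mul, mul_comm]
      _ ≤ ∑ n ∈ (Finset.Icc 1 N).filter (· ∈ exceptionalSet p H), ∑' M, D n M :=
          Finset.sum_le_sum fun n hn => hexc n (Finset.mem_filter.1 hn).2
      _ ≤ ∑ n ∈ Finset.Icc 1 N, ∑' M, D n M :=
          Finset.sum_le_sum_of_subset_of_nonneg (Finset.filter_subset _ _)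
            fun n _ _ => tsum_nonneg (hD0 n)
      _ ≤ ∑ n ∈ Finset.Icc 1 N, ((∑ M ∈ T, D n M) + ε) := Finset.sum_le_sum fun n _ => htail n
      _ = (∑ M ∈ T, ∑ n ∈ Finset.Icc 1 N, D n M) + ε * N := by
          rw [Finset.sum_add_distrib, Finset.sum_comm]
          simp [mul_comm]
      _ ≤ (∑ M ∈ T, ‖c M‖ * ((C / q + ε) * N)) + ε * N := by
          gcongr with M hM
          by_cases hM0 : M = 0
          · simp only [hD, hM0, if_true, Finset.sum_const_zero]
            positivity
          · simp only [hD, hM0, if_false, ← Finset.mul_sum]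
            exact mul_le_mul_of_nonneg_left (hN M hM hM0) (norm_nonneg _)
      _ = (∑ M ∈ T, ‖c M‖) * ((C / q + ε) * N) + ε * N := by rw [Finset.sum_mul]
      _ ≤ 1 * ((C / q + ε) * N) + ε * N := by gcongr
      _ = (C / q + 2 * ε) * N := by ring
  have hfinal : C / q + 2 * ε ≤ μ * ((4 ^ r * C + 1) * (1 / 2) ^ H) := by
    have h1 : C / q ≤ μ * (4 ^ r * C * (1 / 2) ^ H) := by
      have h2 : C / q = μ * (4 ^ r * C * (1 / 2) ^ (r * H)) := by
        have h3 : (100 : ℝ) ^ (r * H) = (50 ^ H) ^ r * 2 ^ (r * H) := by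
          rw [← pow_mul, mul_comm H r, ← mul_pow]; norm_num
        rw [hq, hμ, h3, one_div_pow, one_div_pow, mul_pow]
        field_simp
      rw [h2]
      gcongr μ * (4 ^ r * C * ?_)
      exact pow_le_pow_of_le_one (by norm_num) (by norm_num) (Nat.le_mul_of_pos_left H hr)
    have h4 : 2 * ε = μ * (1 / 2) ^ H := by rw [hε]; ring
    rw [h4]
    linarith
  have h5 := hcount.trans (mul_le_mul_of_nonneg_right hfinal (Nat.cast_nonneg N))
  rw [mul_assoc] at h5
  exact le_of_mul_le_mul_left h5 hμ0

/-- A diagonal choice: if for every `h` the property `P h N` holds for all large `N`, then it holds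
for all large `N` along every `H → ∞` that grows slowly enough. -/
lemma exists_slow_growth {P : ℕ → ℕ → Prop} (hP : ∀ h, ∀ᶠ N in atTop, P h N) :
    ∃ H₀ : ℕ → ℕ, Tendsto H₀ atTop atTop ∧ ∀ H : ℕ → ℕ, Tendsto H atTop atTop →
      (∀ᶠ N in atTop, H N ≤ H₀ N) → ∀ᶠ N in atTop, P (H N) N := by
  classical
  choose N₀ hN₀ using fun h => eventually_atTop.1 (hP h)
  set H₀ : ℕ → ℕ := fun N => Nat.findGreatest (fun h => ∀ h' ≤ h, N₀ h' ≤ N) N with hH₀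
  refine ⟨H₀, tendsto_atTop.2 fun h => ?_, fun H hH hle => ?_⟩
  · filter_upwards [eventually_ge_atTop h, (Filter.eventually_all_finset (Finset.range (h + 1))).2
      fun h' _ => eventually_ge_atTop (N₀ h')] with N hN hN'
    exact Nat.le_findGreatest hN fun h' hh' => hN' h' (Finset.mem_range.2 (by omega))
  · filter_upwards [hle, hH.eventually_ge_atTop 1] with N hN hN1
    exact hN₀ _ N (Nat.findGreatest_of_ne_zero (m := H₀ N) rfl (by omega) (H N) hN)

theorem theorem2 (r : ℕ) (p : Fin r → ℕ) (hp : ∀ i, (p i).Prime) (hodd : ∀ i, Odd (p i))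
    (hinj : Function.Injective p) :
    ∃ H₀ : ℕ → ℕ, Tendsto H₀ atTop atTop ∧
      ∀ H : ℕ → ℕ, Tendsto H atTop atTop → (∀ᶠ N in atTop, H N ≤ H₀ N) →
        ∃ e : ℕ → ℝ, Tendsto e atTop (𝓝 0) ∧
          ∀ β : Fin r → ℕ → ℝ, ∀ N : ℕ, 1 ≤ N →
            1 - e N ≤ ((goodSet p β (H N) N).ncard : ℝ) / (N : ℝ) := by
  classical
  obtain ⟨δ, hδ, hexc⟩ := exists_eventually_card_exceptionalSet_le p hp hodd hinj
  obtain ⟨H₀, hH₀, hslow⟩ := exists_slow_growth hexc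
  refine ⟨H₀, hH₀, fun H hH hle => ?_⟩
  have hev := hslow H hH hle
  refine ⟨fun N => if (((Finset.Icc 1 N).filter (· ∈ exceptionalSet p (H N))).card : ℝ)
    ≤ δ (H N) * N then δ (H N) else 1, ?_, fun β N hN => ?_⟩
  · refine (hδ.comp hH).congr' ?_
    filter_upwards [hev] with N hN
    simp only [Function.comp_apply, if_pos hN]
  · have hNR : (0 : ℝ) < N := by exact_mod_cast hN
    by_cases h : (((Finset.Icc 1 N).filter (· ∈ exceptionalSet p (H N))).card : ℝ) ≤ δ (H N) * N
    swap
    · simp only [if_neg h, sub_self]; positivity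
    simp only [if_pos h]
    have hsub : (((Finset.Icc 1 N).filter (· ∉ exceptionalSet p (H N)) : Finset ℕ) : Set ℕ)
        ⊆ goodSet p β (H N) N := by
      intro n hn
      obtain ⟨hn1, hn2⟩ := Finset.mem_filter.1 (Finset.mem_coe.1 hn)
      obtain ⟨h1, h2⟩ := Finset.mem_Icc.1 hn1
      refine ⟨h1, h2, ?_⟩
      by_contra hcon
      exact hn2 ⟨fun j => β j n, fun s hs1 hs2 hs3 => hcon ⟨s, hs1, hs2, hs3⟩⟩
    have hfin : (goodSet p β (H N) N).Finite :=
      (Set.finite_Icc 1 N).subset fun n hn => ⟨hn.1, hn.2.1⟩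
    have hcard := Set.ncard_le_ncard hsub hfin
    rw [Set.ncard_coe_finset] at hcard
    have hsplit := Finset.card_filter_add_card_filter_not (s := Finset.Icc 1 N)
      (· ∈ exceptionalSet p (H N))
    rw [Nat.card_Icc, Nat.add_sub_cancel] at hsplit
    have hsplitR : (((Finset.Icc 1 N).filter (· ∈ exceptionalSet p (H N))).card : ℝ)
        + ((Finset.Icc 1 N).filter (· ∉ exceptionalSet p (H N))).card = N := by
      exact_mod_cast hsplit
    have hcardR : (((Finset.Icc 1 N).filter (· ∉ exceptionalSet p (H N))).card : ℝ)
        ≤ (goodSet p β (H N) N).ncard := by exact_mod_cast hcard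
    rw [le_div_iff₀ hNR]
    linarith
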